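/- **Setting.** Let $R$ be a Noetherian commutative ring of Krull dimension $\le 4$, let $P_0$ be a finitely generated projective $R$-module of constant rank $2$, and let $\theta_0 : R \xrightarrow{\cong} \det(P_0)=\Lambda^2 P_0$ be an isomorphism. Put $P_4 = P_0\oplus R e_3\oplus R e_4$ and let $\chi_0$ be the non-degenerate alternating form $\chi_0(p,q)=\theta_0^{-1}(p\wedge q)$ on $P_0$. For a finitely generated projective module $P$, $SL(P)$ is the group of automorphisms of determinant $1$, and $Um(P)$ is the set of epimorphisms $P\to R$, on which $SL(P)$ acts on the right by precomposition. For a non-degenerate alternating form $\chi$ on $P$ (i.e. an alternating isomorphism $P\to P^\vee$), $Sp(\chi)$ is the group of automorphisms of $P$ preserving $\chi$. Let $\psi_2=\begin{pmatrix}0&1\\-1&0\end{pmatrix}$, $\psi_{2n+2}=\psi_{2n}\perp\psi_2$. **Groups.** $V(R)$ is the quotient of the free abelian group on isometry classes $[P,g,f]$ of triples ($P$ finitely generated projective, $g,f$ non-degenerate alternating forms on $P$) by the relations $[P\oplus P',g\perp g',f\perp f']=[P,g,f]+[P',g',f']$ and $[P,f_0,f_1]+[P,f_1,f_2]=[P,f_0,f_2]$.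 $V_{SL}(R)$ is obtained by imposing in addition $[P,g,f]=[P,g,\varphi^\vee f\varphi]$ for $\varphi\in SL(P)$. $\tilde V(R)\subset V(R)$ and $\tilde V_{SL}(R)\subset V_{SL}(R)$ are the subgroups of the classes $[R^{2n},\psi_{2n},A]$, where $n \geq 0$ and $A$ is an alternating invertible $2n\times 2n$-matrix with Pfaffian $1$ (they correspond to the groups $W_E(R)$ and $W_{SL}(R)$). **The symbol.** For $a\in Um(P_0\oplus R)$ with a section given by $s\in P_0\oplus R$, $a(s)=1$, let $P(a)=\ker a$ and let $\chi_a$ be the form $\chi_a(p,q)=\theta^{-1}(p\wedge q)$ on $P(a)$, where $\theta: R\xrightarrow{\theta_0}\det(P_0)\cong\det(P_0\oplus R)\cong\det(P(a))$; explicitly, $\chi_a(p,q)$ is the image of $p\wedge q\wedge s$ under the isomorphism $\det(P_0\oplus R)\cong\det(P_0)\xrightarrow{\theta_0^{-1}}R$ that sends $x\wedge y\wedge(0,1)$ to $\theta_0^{-1}(x\wedge y)$. Let $i_s:P_0\oplus R\xrightarrow{\cong}P(a)\oplus R$, $i_s(x)=(x-a(x)s,\,a(x))$, and $V(a,s)=(i_s\oplus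 1)^t(\chi_a\perp\psi_2)(i_s\oplus 1)$, a non-degenerate alternating form on $P_0\oplus R^2=P_4$. **Theorem.** The assignment $a\mapsto[P_0\oplus R^2,\ \chi_0\perp\psi_2,\ V(a,s)]$, for any $s$ with $a(s)=1$, gives a well-defined map, the generalized Vaserstein symbol modulo $SL$, $$V: Um(P_0\oplus R)/SL(P_0\oplus R)\to\tilde V_{SL}(R),$$ and $V$ is injective if and only if $SL(P_4)e_4=Sp(\chi)e_4$ for every non-degenerate alternating form $\chi$ on $P_4$ such that $[P_4,\chi_0\perp\psi_2,\chi]\in\tilde V(R)$. -/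

import Mathlib

universe u

namespace GenVaserstein

noncomputable section

/-! ### Determinants of endomorphisms of finitely generated projective modules -/

section Det

variable {R : Type u} [CommRing R]

/-- If `p ∘ i = id`, so that `i` realizes `M` as a direct summand of `R ^ n` with complement
`Q = ker p`, then `1 + i ∘ (φ - 1) ∘ p` is the endomorphism `φ ⊕ id_Q` of `R ^ n = M ⊕ Q`.
This is its determinant. -/
def detAlong {M : Type*} [AddCommGroup M] [Module R M] {n : ℕ}
    (i : M →ₗ[R] (Fin n → R)) (p : (Fin n → R) →ₗ[R] M) (φ : Module.End R M) : R :=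
  LinearMap.det (1 + i ∘ₗ (φ - 1) ∘ₗ p)

theorem det_one_add_comp_comm {m n : ℕ} (A : (Fin m → R) →ₗ[R] (Fin n → R))
    (B : (Fin n → R) →ₗ[R] (Fin m → R)) :
    LinearMap.det (1 + A ∘ₗ B : Module.End R (Fin n → R)) =
      LinearMap.det (1 + B ∘ₗ A : Module.End R (Fin m → R)) := by
  rw [← LinearMap.det_toMatrix', ← LinearMap.det_toMatrix', map_add, map_add,
    LinearMap.toMatrix'_comp, LinearMap.toMatrix'_comp, LinearMap.toMatrix'_one,
    LinearMap.toMatrix'_one, Matrix.det_one_add_mul_comm]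

variable {M : Type*} [AddCommGroup M] [Module R M]

/-- The determinant does not depend on the way in which `M` is a direct summand of a free
module. -/
theorem detAlong_eq {m n : ℕ} {i : M →ₗ[R] (Fin n → R)} {p : (Fin n → R) →ₗ[R] M}
    {j : M →ₗ[R] (Fin m → R)} {q : (Fin m → R) →ₗ[R] M}
    (h : p ∘ₗ i = LinearMap.id) (h' : q ∘ₗ j = LinearMap.id) (φ : Module.End R M) :
    detAlong i p φ = detAlong j q φ := by
  have h1 : ∀ y, p (i y) = y := fun y => LinearMap.congr_fun h y
  have h2 : ∀ y, q (j y) = y := fun y => LinearMap.congr_fun h' y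
  have e1 : i ∘ₗ (φ - 1) ∘ₗ p = (i ∘ₗ (φ - 1) ∘ₗ q) ∘ₗ (j ∘ₗ p) :=
    LinearMap.ext fun x => by simp [h2]
  have e2 : (j ∘ₗ p) ∘ₗ (i ∘ₗ (φ - 1) ∘ₗ q) = j ∘ₗ (φ - 1) ∘ₗ q :=
    LinearMap.ext fun x => by simp [h1]
  rw [detAlong, e1, det_one_add_comp_comm, e2, detAlong]

theorem detAlong_mul {n : ℕ} {i : M →ₗ[R] (Fin n → R)} {p : (Fin n → R) →ₗ[R] M}
    (h : p ∘ₗ i = LinearMap.id) (φ ψ : Module.End R M) :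
    detAlong i p (φ * ψ) = detAlong i p φ * detAlong i p ψ := by
  rw [detAlong, detAlong, detAlong, ← map_mul]
  congr 1
  refine LinearMap.ext fun x => ?_
  have h1 : ∀ y, p (i y) = y := fun y => LinearMap.congr_fun h y
  simp [h1]
  abel

variable (R M) in
/-- The determinant of endomorphisms of a finitely generated projective module, as a monoid
homomorphism. -/
def pdet [Module.Finite R M] [Module.Projective R M] : Module.End R M →* R where
  toFun := detAlong
    (Module.Finite.exists_comp_eq_id_of_projective R M).choose_spec.choose_spec.choose
    (Module.Finite.exists_comp_eq_id_of_projective R M).choose_spec.choose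
  map_one' := by simp [detAlong]
  map_mul' := detAlong_mul
    (Module.Finite.exists_comp_eq_id_of_projective R M).choose_spec.choose_spec.choose_spec.2.2

theorem pdet_eq_detAlong [Module.Finite R M] [Module.Projective R M] {n : ℕ}
    {i : M →ₗ[R] (Fin n → R)} {p : (Fin n → R) →ₗ[R] M}
    (h : p ∘ₗ i = LinearMap.id) (φ : Module.End R M) : pdet R M φ = detAlong i p φ :=
  detAlong_eq
    (Module.Finite.exists_comp_eq_id_of_projective R M).choose_spec.choose_spec.choose_spec.2.2
    h φ

/-- On free modules this is the usual determinant. -/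
theorem pdet_eq_det [Module.Finite R M] [Module.Free R M] (φ : Module.End R M) :
    pdet R M φ = LinearMap.det φ := by
  rcases subsingleton_or_nontrivial R with hR | hR
  · exact Subsingleton.elim _ _
  let e : M ≃ₗ[R] (Fin (Module.finrank R M) → R) := (Module.finBasis R M).equivFun
  have h : e.symm.toLinearMap ∘ₗ e.toLinearMap = LinearMap.id := by ext; simp
  rw [pdet_eq_detAlong h, detAlong, ← LinearMap.det_conj φ e]
  congr 1
  refine LinearMap.ext fun x => ?_
  simp

variable (R M) in
/-- `SL(M)`: the automorphisms of determinant one. -/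
def SL [Module.Finite R M] [Module.Projective R M] : Subgroup (M ≃ₗ[R] M) where
  carrier := {φ | pdet R M (φ : M →ₗ[R] M) = 1}
  one_mem' := map_one (pdet R M)
  mul_mem' := by
    intro φ ψ hφ hψ
    have := map_mul (pdet R M) (φ : M →ₗ[R] M) (ψ : M →ₗ[R] M)
    rw [Set.mem_ofPred_eq] at hφ hψ ⊢
    rw [hφ, hψ, one_mul] at this
    exact this
  inv_mem' := by
    intro φ hφ
    have := map_mul (pdet R M) (φ : M →ₗ[R] M) ((φ⁻¹ : M ≃ₗ[R] M) : M →ₗ[R] M)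
    have h1 : (φ : M →ₗ[R] M) * ((φ⁻¹ : M ≃ₗ[R] M) : M →ₗ[R] M) = 1 := by
      ext x
      exact φ.apply_symm_apply x
    rw [Set.mem_ofPred_eq] at hφ ⊢
    rw [h1, map_one, hφ, one_mul] at this
    exact this.symm

end Det

/-! ### Unimodular maps and the orbit space `Um(M)/SL(M)` -/

section Um

variable (R : Type u) [CommRing R] (M : Type*) [AddCommGroup M] [Module R M]

/-- `Um(M)`: the epimorphisms `M → R`. -/
def Um : Type _ := {a : M →ₗ[R] R // Function.Surjective a}

/-- Two epimorphisms are equivalent if they lie in the same orbit of the right action of `SL(M)`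
by precomposition. -/
def umSetoid [Module.Finite R M] [Module.Projective R M] : Setoid (Um R M) where
  r a b := ∃ φ ∈ SL R M, b.1 = a.1 ∘ₗ (φ : M →ₗ[R] M)
  iseqv := by
    refine ⟨fun a => ⟨1, one_mem _, rfl⟩, ?_, ?_⟩
    · rintro a b ⟨φ, hφ, h⟩
      refine ⟨φ⁻¹, inv_mem hφ, ?_⟩
      rw [h]
      ext x
      exact congrArg a.1 (φ.apply_symm_apply x).symm
    · rintro a b c ⟨φ, hφ, h⟩ ⟨ψ, hψ, h'⟩
      exact ⟨φ * ψ, mul_mem hφ hψ, by rw [h', h]; rfl⟩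

/-- The orbit space `Um(M)/SL(M)`. -/
def UmModSL [Module.Finite R M] [Module.Projective R M] : Type _ := Quotient (umSetoid R M)

variable {R M} in
/-- The orbit of an epimorphism. -/
def UmModSL.mk [Module.Finite R M] [Module.Projective R M] (a : Um R M) : UmModSL R M :=
  Quotient.mk (umSetoid R M) a

end Um

/-! ### Non-degenerate alternating forms -/

/-- Non-degenerate alternating forms on `M`, i.e. alternating isomorphisms `M → Hom(M, R)`. -/
structure AltForm (R : Type u) [CommRing R] (M : Type*) [AddCommGroup M] [Module R M] where
  form : M →ₗ[R] M →ₗ[R] R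
  alt : ∀ x, form x x = 0
  bij : Function.Bijective form

namespace AltForm

variable {R : Type u} [CommRing R] {M N : Type*} [AddCommGroup M] [Module R M]
  [AddCommGroup N] [Module R N]

/-- The form `f ↦ hᵗ f h`, i.e. `(x, y) ↦ f (h x) (h y)`, for an isomorphism `h`. -/
def pullback (f : AltForm R N) (h : M ≃ₗ[R] N) : AltForm R M where
  form := f.form.compl₁₂ (h : M →ₗ[R] N) (h : M →ₗ[R] N)
  alt x := f.alt (h x)
  bij := by
    constructor
    · intro x y hxy
      refine h.injective (f.bij.1 (LinearMap.ext fun z => ?_))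
      have := LinearMap.congr_fun hxy (h.symm z)
      simpa using this
    · intro l
      obtain ⟨z, hz⟩ := f.bij.2 (l ∘ₗ (h.symm : N →ₗ[R] M))
      refine ⟨h.symm z, LinearMap.ext fun y => ?_⟩
      have := LinearMap.congr_fun hz (h y)
      simpa using this

/-- The orthogonal sum `f ⊥ g`. -/
def perp (f : AltForm R M) (g : AltForm R N) : AltForm R (M × N) where
  form := f.form.compl₁₂ (LinearMap.fst R M N) (LinearMap.fst R M N) +
    g.form.compl₁₂ (LinearMap.snd R M N) (LinearMap.snd R M N)
  alt x := by simp [f.alt, g.alt]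
  bij := by
    constructor
    · intro x y hxy
      refine Prod.ext (f.bij.1 (LinearMap.ext fun z => ?_)) (g.bij.1 (LinearMap.ext fun z => ?_))
      · simpa using LinearMap.congr_fun hxy (z, 0)
      · simpa using LinearMap.congr_fun hxy (0, z)
    · intro l
      obtain ⟨x, hx⟩ := f.bij.2 (l ∘ₗ LinearMap.inl R M N)
      obtain ⟨y, hy⟩ := g.bij.2 (l ∘ₗ LinearMap.inr R M N)
      refine ⟨(x, y), LinearMap.ext fun z => ?_⟩
      have h1 := LinearMap.congr_fun hx z.1
      have h2 := LinearMap.congr_fun hy z.2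
      simp only [LinearMap.comp_apply, LinearMap.inl_apply, LinearMap.inr_apply] at h1 h2
      simp [h1, h2, ← map_add]

/-- `Sp(f)`: the automorphisms of `M` that preserve the form `f`. -/
def Sp (f : AltForm R M) : Subgroup (M ≃ₗ[R] M) where
  carrier := {φ | ∀ x y, f.form (φ x) (φ y) = f.form x y}
  one_mem' _ _ := rfl
  mul_mem' := by
    intro φ ψ hφ hψ x y
    exact (hφ _ _).trans (hψ x y)
  inv_mem' := by
    intro φ hφ x y
    have := hφ (φ.symm x) (φ.symm y)
    simp only [LinearEquiv.apply_symm_apply] at this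
    exact this.symm

end AltForm

section Matrices

variable {R : Type u} [CommRing R]

/-- The set `A_n(R)` of alternating invertible matrices. -/
def IsAlternatingInvertible {n : ℕ} (A : Matrix (Fin n) (Fin n) R) : Prop :=
  A.transpose = -A ∧ (∀ i, A i i = 0) ∧ IsUnit A.det

/-- The matrix `ψ₂`. -/
def psi2 (R : Type u) [CommRing R] : Matrix (Fin 2) (Fin 2) R := !![0, 1; -1, 0]

/-- The matrices `ψ_{2n}`, where `ψ_{2n+2} = ψ_{2n} ⊥ ψ₂`. -/
def psi (R : Type u) [CommRing R] : (n : ℕ) → Matrix (Fin (2 * n)) (Fin (2 * n)) R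
  | 0 => 0
  | n + 1 => (Matrix.fromBlocks (psi R n) 0 0 (psi2 R)).submatrix
      (finSumFinEquiv (m := 2 * n) (n := 2)).symm (finSumFinEquiv (m := 2 * n) (n := 2)).symm

/-- The Pfaffian of an alternating matrix of size `2n`, by expansion along the first row. -/
def pf : (n : ℕ) → Matrix (Fin (2 * n)) (Fin (2 * n)) R → R
  | 0, _ => 1
  | n + 1, A => ∑ j : Fin (2 * n + 1), (-1) ^ (j : ℕ) *
      A (0 : Fin (2 * n + 1 + 1)) j.succ *
        pf n (A.submatrix (fun i : Fin (2 * n) => (j.succAbove i).succ)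
          (fun i : Fin (2 * n) => (j.succAbove i).succ))

theorem psi2_isAlternatingInvertible : IsAlternatingInvertible (psi2 R) := by
  refine ⟨?_, ?_, ?_⟩
  · ext i j; fin_cases i <;> fin_cases j <;> simp [psi2]
  · intro i; fin_cases i <;> simp [psi2]
  · simp [psi2, Matrix.det_fin_two]

theorem psi_isAlternatingInvertible (n : ℕ) : IsAlternatingInvertible (psi R n) := by
  induction n with
  | zero => exact ⟨by ext i; exact i.elim0, fun i => i.elim0, by simp⟩
  | succ n ih =>
    obtain ⟨h1, h2, h3⟩ := ih
    obtain ⟨k1, k2, k3⟩ := psi2_isAlternatingInvertible (R := R)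
    refine ⟨?_, ?_, ?_⟩
    · rw [psi, Matrix.transpose_submatrix, Matrix.fromBlocks_transpose, h1, k1]
      ext i j
      simp only [Matrix.submatrix_apply, Matrix.neg_apply]
      rcases (finSumFinEquiv (m := 2 * n) (n := 2)).symm i with i | i <;>
        rcases (finSumFinEquiv (m := 2 * n) (n := 2)).symm j with j | j <;> simp
    · intro i
      simp only [psi, Matrix.submatrix_apply]
      rcases (finSumFinEquiv (m := 2 * n) (n := 2)).symm i with i | i <;> simp [h2, k2]
    · have : (psi R (n + 1)).det = (psi R n).det * (psi2 R).det := by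
        rw [psi, ← Matrix.det_fromBlocks_zero₂₁]
        exact Matrix.det_submatrix_equiv_self (finSumFinEquiv (m := 2 * n) (n := 2)).symm _
      rw [this]
      exact h3.mul k3

/-- The form `(x, y) ↦ xᵗ A y` on `R ^ n` of an alternating invertible matrix `A`. -/
def AltForm.ofMatrix {n : ℕ} (A : Matrix (Fin n) (Fin n) R) (hA : IsAlternatingInvertible A) :
    AltForm R (Fin n → R) where
  form := Matrix.toLinearMap₂' R A
  alt x := by
    rw [Matrix.toLinearMap₂'_apply']
    simp only [dotProduct, Matrix.mulVec, Finset.mul_sum]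
    rw [← Finset.sum_product']
    refine Finset.sum_involution (fun p _ => (p.2, p.1)) ?_ ?_ ?_ ?_
    · rintro ⟨i, j⟩ -
      have := congrFun (congrFun hA.1 i) j
      simp only [Matrix.transpose_apply, Matrix.neg_apply] at this
      simp only [this]
      ring
    · rintro ⟨i, j⟩ - hne heq
      simp only [Prod.mk.injEq] at heq
      rw [heq.1] at hne
      exact hne (by simp [hA.2.1])
    · simp
    · simp
  bij := by
    have key : ∀ x y, Matrix.toLinearMap₂' R A x y = Matrix.vecMul x A ⬝ᵥ y := by
      intro x y
      rw [Matrix.toLinearMap₂'_apply', Matrix.dotProduct_mulVec]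
    constructor
    · intro x y hxy
      have h : Matrix.vecMul x A = Matrix.vecMul y A := by
        ext i
        have := LinearMap.congr_fun hxy (Pi.single i 1)
        simpa [key] using this
      have h' := congrArg (fun v => Matrix.vecMul v A⁻¹) h
      simpa [Matrix.vecMul_vecMul, Matrix.mul_nonsing_inv _ hA.2.2] using h'
    · intro l
      refine ⟨Matrix.vecMul (fun i => l (Pi.single i 1)) A⁻¹, ?_⟩
      refine LinearMap.pi_ext' fun i => LinearMap.ext_ring ?_
      simp [key, Matrix.vecMul_vecMul, Matrix.nonsing_inv_mul _ hA.2.2]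

/-- The form `ψ₂` on `R ⊕ R`, which sends `((a, b), (c, d))` to `a d - b c`. -/
def psiForm (R : Type u) [CommRing R] : AltForm R (R × R) :=
  (AltForm.ofMatrix (psi2 R) psi2_isAlternatingInvertible).pullback
    (LinearEquiv.finTwoArrow R R).symm

theorem psiForm_apply (x y : R × R) : (psiForm R).form x y = x.1 * y.2 - x.2 * y.1 := by
  simp [psiForm, AltForm.pullback, AltForm.ofMatrix, Matrix.toLinearMap₂'_apply', psi2,
    Matrix.vecHead, Matrix.vecTail]
  ring

end Matrices

/-! ### The groups `V(R)` and `V_SL(R)` and their subgroups -/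

/-- Triples `(P, g, f)` where `P` is a finitely generated projective `R`-module and `g`, `f` are
non-degenerate alternating forms on `P`. -/
structure Triple (R : Type u) [CommRing R] where
  carrier : Type u
  [grp : AddCommGroup carrier]
  [mod : Module R carrier]
  [fin : Module.Finite R carrier]
  [proj : Module.Projective R carrier]
  fst : AltForm R carrier
  snd : AltForm R carrier

attribute [instance] Triple.grp Triple.mod Triple.fin Triple.proj

section Groups

variable (R : Type u) [CommRing R]

/-- Isometry of triples. -/
def isometrySetoid : Setoid (Triple R) where
  r S T := ∃ h : S.carrier ≃ₗ[R] T.carrier,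
    (∀ x y, S.fst.form x y = T.fst.form (h x) (h y)) ∧
    (∀ x y, S.snd.form x y = T.snd.form (h x) (h y))
  iseqv := by
    refine ⟨fun S => ⟨LinearEquiv.refl R _, fun _ _ => rfl, fun _ _ => rfl⟩, ?_, ?_⟩
    · rintro S T ⟨h, h1, h2⟩
      exact ⟨h.symm, fun x y => by simp [h1], fun x y => by simp [h2]⟩
    · rintro S T U ⟨h, h1, h2⟩ ⟨k, k1, k2⟩
      exact ⟨h.trans k, fun x y => by simp [h1, k1], fun x y => by simp [h2, k2]⟩

/-- Isometry classes of triples. -/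
def IsometryClass : Type (u + 1) := Quotient (isometrySetoid R)

variable {R}

/-- The generator of the free abelian group on isometry classes given by the isometry class of
`(P, g, f)`. -/
def gen {P : Type u} [AddCommGroup P] [Module R P] [Module.Finite R P] [Module.Projective R P]
    (g f : AltForm R P) : FreeAbelianGroup (IsometryClass R) :=
  FreeAbelianGroup.of (Quotient.mk (isometrySetoid R) ⟨P, g, f⟩)

/-- The relators `[P ⊕ P', g ⊥ g', f ⊥ f'] - [P, g, f] - [P', g', f']` and
`[P, f₀, f₁] + [P, f₁, f₂] - [P, f₀, f₂]`. -/
inductive VRelator : FreeAbelianGroup (IsometryClass R) → Prop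
  | sum {P P' : Type u} [AddCommGroup P] [Module R P] [Module.Finite R P] [Module.Projective R P]
      [AddCommGroup P'] [Module R P'] [Module.Finite R P'] [Module.Projective R P']
      (g f : AltForm R P) (g' f' : AltForm R P') :
      VRelator (gen (g.perp g') (f.perp f') - gen g f - gen g' f')
  | chain {P : Type u} [AddCommGroup P] [Module R P] [Module.Finite R P] [Module.Projective R P]
      (f₀ f₁ f₂ : AltForm R P) :
      VRelator (gen f₀ f₁ + gen f₁ f₂ - gen f₀ f₂)

/-- The relators of `V(R)` together with `[P, g, f] - [P, g, φᵗ f φ]` for `φ ∈ SL(P)`. -/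
inductive VSLRelator : FreeAbelianGroup (IsometryClass R) → Prop
  | base {x : FreeAbelianGroup (IsometryClass R)} (hx : VRelator x) : VSLRelator x
  | special {P : Type u} [AddCommGroup P] [Module R P] [Module.Finite R P]
      [Module.Projective R P] (g f : AltForm R P) (φ : P ≃ₗ[R] P) (hφ : φ ∈ SL R P) :
      VSLRelator (gen g f - gen g (f.pullback φ))

variable (R)

/-- The group `V(R)`. -/
abbrev V : Type (u + 1) :=
  FreeAbelianGroup (IsometryClass R) ⧸
    AddSubgroup.closure {x : FreeAbelianGroup (IsometryClass R) | VRelator x}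

/-- The group `V_SL(R)`. -/
abbrev VSL : Type (u + 1) :=
  FreeAbelianGroup (IsometryClass R) ⧸
    AddSubgroup.closure {x : FreeAbelianGroup (IsometryClass R) | VSLRelator x}

variable {R}

/-- The class `[P, g, f]` in `V(R)`. -/
def V.cls {P : Type u} [AddCommGroup P] [Module R P] [Module.Finite R P] [Module.Projective R P]
    (g f : AltForm R P) : V R :=
  QuotientAddGroup.mk (gen g f)

/-- The class `[P, g, f]` in `V_SL(R)`. -/
def VSL.cls {P : Type u} [AddCommGroup P] [Module R P] [Module.Finite R P]
    [Module.Projective R P] (g f : AltForm R P) : VSL R :=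
  QuotientAddGroup.mk (gen g f)

variable (R)

/-- The subgroup `Ṽ(R)` of `V(R)`. The isomorphism from `W'_E(R)` to `V(R)` sends the class of an
alternating invertible matrix `A` of size `2n` to `[R ^ (2n), ψ_{2n}, A]`, and `Ṽ(R)` is the image
of the kernel `W_E(R)` of the Pfaffian, i.e. it consists of the classes with `Pf A = 1`. -/
def Vtilde : AddSubgroup (V R) :=
  AddSubgroup.closure {x | ∃ (n : ℕ) (A : Matrix (Fin (2 * n)) (Fin (2 * n)) R)
    (hA : IsAlternatingInvertible A), pf n A = 1 ∧
      x = V.cls (AltForm.ofMatrix (psi R n) (psi_isAlternatingInvertible n))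
        (AltForm.ofMatrix A hA)}

/-- The subgroup `Ṽ_SL(R)` of `V_SL(R)`, which corresponds in the same way to the kernel
`W_SL(R)` of the Pfaffian on `W'_SL(R)`. -/
def VtildeSL : AddSubgroup (VSL R) :=
  AddSubgroup.closure {x | ∃ (n : ℕ) (A : Matrix (Fin (2 * n)) (Fin (2 * n)) R)
    (hA : IsAlternatingInvertible A), pf n A = 1 ∧
      x = VSL.cls (AltForm.ofMatrix (psi R n) (psi_isAlternatingInvertible n))
        (AltForm.ofMatrix A hA)}

end Groups

/-! ### A criterion for non-degeneracy -/

section Nondegenerate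

variable {R : Type u} [CommRing R] {M : Type*} [AddCommGroup M] [Module R M]

theorem skew_of_alt {B : M →ₗ[R] M →ₗ[R] R} (halt : ∀ x, B x x = 0) (x y : M) :
    B y x = -B x y := by
  have := halt (x + y)
  simp only [map_add, LinearMap.add_apply, halt] at this
  linear_combination this

/-- An alternating form which satisfies the Pluecker relation of a rank two module, and whose
values generate the unit ideal, is non-degenerate. -/
theorem bijective_of_plucker {B : M →ₗ[R] M →ₗ[R] R} (halt : ∀ x, B x x = 0)
    (hpl : ∀ x y z, B x y • z + B y z • x + B z x • y = 0)
    (hspan : Ideal.span {r | ∃ x y, B x y = r} = ⊤) : Function.Bijective B := by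
  constructor
  · rw [injective_iff_map_eq_zero]
    intro z hz
    have hle : Ideal.span {r | ∃ x y, B x y = r} ≤ LinearMap.ker (LinearMap.toSpanSingleton R M z) := by
      rw [Ideal.span_le]
      rintro _ ⟨x, y, rfl⟩
      have h1 := hpl x y z
      rw [skew_of_alt halt z y, hz] at h1
      simpa using h1
    rw [hspan] at hle
    simpa using hle (x := 1) trivial
  · intro l
    have hle : Ideal.span {r | ∃ x y, B x y = r} ≤
        (LinearMap.range B).comap (LinearMap.toSpanSingleton R _ l) := by
      rw [Ideal.span_le]
      rintro _ ⟨x, y, rfl⟩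
      refine ⟨l y • x - l x • y, LinearMap.ext fun z => ?_⟩
      have h1 := congrArg l (hpl x y z)
      simp only [map_add, map_smul, smul_eq_mul, map_zero] at h1
      simp only [map_sub, map_smul, LinearMap.sub_apply, LinearMap.smul_apply, smul_eq_mul,
        LinearMap.toSpanSingleton_apply]
      rw [skew_of_alt halt x z] at h1
      linear_combination -h1
    rw [hspan] at hle
    simpa using hle (x := 1) trivial

/-- At each prime, a finitely generated projective module of rank two is generated by two
elements. -/
theorem exists_local_generators [Module.Finite R M] [Module.Projective R M]
    (p : PrimeSpectrum R) (hp : Module.rankAtStalk M p = 2) :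
    ∃ b : Fin 2 → M, ∀ x, ∃ s ∉ p.asIdeal, ∃ c : Fin 2 → R, s • x = c 0 • b 0 + c 1 • b 1 := by
  let S := p.asIdeal.primeCompl
  let f := LocalizedModule.mkLinearMap S M
  have : Module.Free (Localization.AtPrime p.asIdeal) (LocalizedModule S M) :=
    Module.free_of_flat_of_isLocalRing
  let B := Module.finBasisOfFinrankEq (Localization.AtPrime p.asIdeal) (LocalizedModule S M) hp
  have hB : ∀ i, ∃ y : M × S, IsLocalizedModule.mk' f y.1 y.2 = B i := fun i =>
    IsLocalizedModule.mk'_surjective S f (B i)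
  choose y hy using hB
  refine ⟨fun i => (y i).1, fun x => ?_⟩
  let N : Submodule R M := Submodule.span R {(y 0).1, (y 1).1}
  have hN : N.localized' (Localization.AtPrime p.asIdeal) S f = ⊤ := by
    rw [eq_top_iff, ← B.span_eq, Submodule.span_le]
    rintro _ ⟨i, rfl⟩
    refine (Submodule.mem_localized' _ _ _ _ _).2 ⟨(y i).1, ?_, (y i).2, hy i⟩
    refine Submodule.subset_span ?_
    fin_cases i <;> simp
  have hx : f x ∈ N.localized' (Localization.AtPrime p.asIdeal) S f := by rw [hN]; trivial
  obtain ⟨m, hm, t, ht⟩ := (Submodule.mem_localized' _ _ _ _ _).1 hx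
  rw [IsLocalizedModule.mk'_eq_iff] at ht
  have ht' : f m = f (t • x) := by rw [ht, Submonoid.smul_def, Submonoid.smul_def, map_smul]
  obtain ⟨c, hc⟩ := (IsLocalizedModule.eq_iff_exists S f).1 ht'
  obtain ⟨α, β, h⟩ := Submodule.mem_span_pair.1 hm
  refine ⟨c * t, (c * t).2, ![c * α, c * β], ?_⟩
  simp only [Submonoid.smul_def] at hc
  rw [mul_smul, ← hc, ← h]
  simp
  module

theorem plucker_of_rank_two [Module.Finite R M] [Module.Projective R M]
    (hrk : ∀ p : PrimeSpectrum R, Module.rankAtStalk M p = 2)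
    {B : M →ₗ[R] M →ₗ[R] R} (halt : ∀ x, B x x = 0) (x y z : M) :
    B x y • z + B y z • x + B z x • y = 0 := by
  set t := B x y • z + B y z • x + B z x • y with ht
  by_contra hne
  have hI : LinearMap.ker (LinearMap.toSpanSingleton R M t) ≠ ⊤ := by
    intro h
    have : (1 : R) ∈ LinearMap.ker (LinearMap.toSpanSingleton R M t) := by rw [h]; trivial
    exact hne (by simpa using this)
  obtain ⟨m, hm, hle⟩ := Ideal.exists_le_maximal _ hI
  obtain ⟨b, hb⟩ := exists_local_generators (M := M) ⟨m, hm.isPrime⟩ (hrk _)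
  obtain ⟨s1, hs1, c1, h1⟩ := hb x
  obtain ⟨s2, hs2, c2, h2⟩ := hb y
  obtain ⟨s3, hs3, c3, h3⟩ := hb z
  have hmem : s1 * s2 * s3 ∈ LinearMap.ker (LinearMap.toSpanSingleton R M t) := by
    rw [LinearMap.mem_ker, LinearMap.toSpanSingleton_apply]
    have e : (s1 * s2 * s3) • t = B (s1 • x) (s2 • y) • (s3 • z) +
        B (s2 • y) (s3 • z) • (s1 • x) + B (s3 • z) (s1 • x) • (s2 • y) := by
      simp only [ht, map_smul, LinearMap.smul_apply, smul_eq_mul]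
      module
    rw [e, h1, h2, h3]
    simp only [map_add, map_smul, LinearMap.add_apply, LinearMap.smul_apply, smul_eq_mul, halt,
      skew_of_alt halt (b 0) (b 1)]
    module
  have := hle hmem
  rcases hm.isPrime.mem_or_mem this with h | h
  · rcases hm.isPrime.mem_or_mem h with h | h
    · exact hs1 h
    · exact hs2 h
  · exact hs3 h

end Nondegenerate

/-! ### The generalized Vaserstein symbol -/

section Symbol

variable {R : Type u} [CommRing R] {P₀ : Type u} [AddCommGroup P₀] [Module R P₀]

theorem wedge_add_left (x x' y : P₀) : exteriorPower.ιMulti R 2 ![x + x', y] =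
    exteriorPower.ιMulti R 2 ![x, y] + exteriorPower.ιMulti R 2 ![x', y] := by
  have h : ∀ t : P₀, Function.update ![x, y] 0 t = ![t, y] := fun t => by
    ext i; fin_cases i <;> rfl
  have := (exteriorPower.ιMulti R 2 (M := P₀)).map_update_add ![x, y] 0 x x'
  rwa [h, h, h] at this

theorem wedge_smul_left (c : R) (x y : P₀) : exteriorPower.ιMulti R 2 ![c • x, y] =
    c • exteriorPower.ιMulti R 2 ![x, y] := by
  have h : ∀ t : P₀, Function.update ![x, y] 0 t = ![t, y] := fun t => by
    ext i; fin_cases i <;> rfl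
  have := (exteriorPower.ιMulti R 2 (M := P₀)).map_update_smul ![x, y] 0 c x
  rwa [h, h] at this

theorem wedge_add_right (x y y' : P₀) : exteriorPower.ιMulti R 2 ![x, y + y'] =
    exteriorPower.ιMulti R 2 ![x, y] + exteriorPower.ιMulti R 2 ![x, y'] := by
  have h : ∀ t : P₀, Function.update ![x, y] 1 t = ![x, t] := fun t => by
    ext i; fin_cases i <;> rfl
  have := (exteriorPower.ιMulti R 2 (M := P₀)).map_update_add ![x, y] 1 y y'
  rwa [h, h, h] at this

theorem wedge_smul_right (c : R) (x y : P₀) : exteriorPower.ιMulti R 2 ![x, c • y] =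
    c • exteriorPower.ιMulti R 2 ![x, y] := by
  have h : ∀ t : P₀, Function.update ![x, y] 1 t = ![x, t] := fun t => by
    ext i; fin_cases i <;> rfl
  have := (exteriorPower.ιMulti R 2 (M := P₀)).map_update_smul ![x, y] 1 c y
  rwa [h, h] at this

/-- The bilinear form `(p, q) ↦ θ₀⁻¹ (p ∧ q)` on `P₀`. -/
def chi0Bilin (θ₀ : R ≃ₗ[R] ⋀[R]^2 P₀) : P₀ →ₗ[R] P₀ →ₗ[R] R :=
  LinearMap.mk₂ R (fun p q => θ₀.symm (exteriorPower.ιMulti R 2 ![p, q]))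
    (fun x x' y => by rw [wedge_add_left, map_add])
    (fun c x y => by rw [wedge_smul_left, map_smul])
    (fun x y y' => by rw [wedge_add_right, map_add])
    (fun c x y => by rw [wedge_smul_right, map_smul])

theorem chi0Bilin_apply (θ₀ : R ≃ₗ[R] ⋀[R]^2 P₀) (p q : P₀) :
    chi0Bilin θ₀ p q = θ₀.symm (exteriorPower.ιMulti R 2 ![p, q]) := rfl

theorem chi0Bilin_self (θ₀ : R ≃ₗ[R] ⋀[R]^2 P₀) (p : P₀) : chi0Bilin θ₀ p p = 0 := by
  rw [chi0Bilin_apply, (exteriorPower.ιMulti R 2).map_eq_zero_of_eq ![p, p] (i := 0) (j := 1)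
    (by simp) (by simp), map_zero]

theorem chi0Bilin_span (θ₀ : R ≃ₗ[R] ⋀[R]^2 P₀) :
    Ideal.span {r | ∃ x y, chi0Bilin θ₀ x y = r} = ⊤ := by
  have h := congrArg (Submodule.map (θ₀.symm : ⋀[R]^2 P₀ →ₗ[R] R))
    (exteriorPower.ιMulti_span R 2 P₀)
  rw [Submodule.map_span, Submodule.map_top, LinearEquiv.range] at h
  rw [eq_top_iff, ← h]
  refine Submodule.span_mono ?_
  rintro _ ⟨_, ⟨v, rfl⟩, rfl⟩
  refine ⟨v 0, v 1, ?_⟩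
  rw [chi0Bilin_apply]
  have : ![v 0, v 1] = v := by ext i; fin_cases i <;> rfl
  rw [this]
  rfl

/-- The form `χ₀` on `P₀` given by `χ₀ (p, q) = θ₀⁻¹ (p ∧ q)`. -/
def chi0 [Module.Finite R P₀] [Module.Projective R P₀]
    (hrk : ∀ p : PrimeSpectrum R, Module.rankAtStalk P₀ p = 2) (θ₀ : R ≃ₗ[R] ⋀[R]^2 P₀) :
    AltForm R P₀ where
  form := chi0Bilin θ₀
  alt := chi0Bilin_self θ₀
  bij := bijective_of_plucker (chi0Bilin_self θ₀)
    (plucker_of_rank_two hrk (chi0Bilin_self θ₀)) (chi0Bilin_span θ₀)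

variable (R P₀) in
/-- The canonical map `det (P₀ ⊕ R) → det P₀` for `P₀` of rank two, as the linear map
`⋀³ (P₀ ⊕ R) → ⋀² P₀` that sends `x₀ ∧ x₁ ∧ x₂` to
`r₀ p₁ ∧ p₂ - r₁ p₀ ∧ p₂ + r₂ p₀ ∧ p₁`, where `xᵢ = (pᵢ, rᵢ)`; in particular it sends
`p ∧ q ∧ (0, 1)` to `p ∧ q`. -/
def detSum : ⋀[R]^3 (P₀ × R) →ₗ[R] ⋀[R]^2 P₀ :=
  exteriorPower.alternatingMapLinearEquiv
    (AlternatingMap.alternatizeUncurryFin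
      ((LinearMap.snd R P₀ R).smulRight
        ((exteriorPower.ιMulti R 2).compLinearMap (LinearMap.fst R P₀ R))))

theorem detSum_apply (x y z : P₀ × R) :
    detSum R P₀ (exteriorPower.ιMulti R 3 ![x, y, z]) =
      x.2 • exteriorPower.ιMulti R 2 ![y.1, z.1] - y.2 • exteriorPower.ιMulti R 2 ![x.1, z.1]
        + z.2 • exteriorPower.ιMulti R 2 ![x.1, y.1] := by
  have e0 : (fun i => (Fin.removeNth 0 ![x, y, z] i).1) = ![y.1, z.1] := by
    ext i; fin_cases i <;> rfl
  have e1 : (fun i => (Fin.removeNth 1 ![x, y, z] i).1) = ![x.1, z.1] := by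
    ext i; fin_cases i <;> rfl
  have e2 : (fun i => (Fin.removeNth 2 ![x, y, z] i).1) = ![x.1, y.1] := by
    ext i; fin_cases i <;> rfl
  rw [detSum, exteriorPower.alternatingMapLinearEquiv_apply_ιMulti,
    AlternatingMap.alternatizeUncurryFin_apply, Fin.sum_univ_three]
  simp only [LinearMap.smulRight_apply, AlternatingMap.smul_apply,
    AlternatingMap.compLinearMap_apply, LinearMap.snd_apply, LinearMap.fst_apply,
    e0, e1, e2]
  simp [sub_eq_add_neg]

theorem theta_detSum (θ₀ : R ≃ₗ[R] ⋀[R]^2 P₀) (x y z : P₀ × R) :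
    θ₀.symm (detSum R P₀ (exteriorPower.ιMulti R 3 ![x, y, z])) =
      x.2 * chi0Bilin θ₀ y.1 z.1 - y.2 * chi0Bilin θ₀ x.1 z.1 + z.2 * chi0Bilin θ₀ x.1 y.1 := by
  rw [detSum_apply]
  simp [chi0Bilin_apply]

/-- The bilinear form `(p, q) ↦ θ⁻¹ (p ∧ q)` on `P(a) = ker a`, where `θ : R ≅ det P(a)` is
obtained from `θ₀` and the isomorphism `det P(a) ≅ det (P₀ ⊕ R) ≅ det P₀` given by the section `s`
of `a`, which sends `p ∧ q` to the image of `p ∧ q ∧ s`. -/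
def chiBilin (θ₀ : R ≃ₗ[R] ⋀[R]^2 P₀) (a : (P₀ × R) →ₗ[R] R) (s : P₀ × R) :
    LinearMap.ker a →ₗ[R] LinearMap.ker a →ₗ[R] R :=
  LinearMap.mk₂ R (fun p q =>
      θ₀.symm (detSum R P₀ (exteriorPower.ιMulti R 3 ![(p : P₀ × R), (q : P₀ × R), s])))
    (fun x x' y => by simp only [theta_detSum]; simp; ring)
    (fun c x y => by simp only [theta_detSum]; simp; ring)
    (fun x y y' => by simp only [theta_detSum]; simp; ring)
    (fun c x y => by simp only [theta_detSum]; simp; ring)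

theorem chiBilin_apply (θ₀ : R ≃ₗ[R] ⋀[R]^2 P₀) (a : (P₀ × R) →ₗ[R] R) (s : P₀ × R)
    (p q : LinearMap.ker a) : chiBilin θ₀ a s p q =
      p.1.2 * chi0Bilin θ₀ q.1.1 s.1 - q.1.2 * chi0Bilin θ₀ p.1.1 s.1
        + s.2 * chi0Bilin θ₀ p.1.1 q.1.1 :=
  theta_detSum θ₀ p.1 q.1 s

/-- The relation between four elements of `P₀ ⊕ R`. -/
theorem cramer_four [Module.Finite R P₀] [Module.Projective R P₀]
    (hrk : ∀ p : PrimeSpectrum R, Module.rankAtStalk P₀ p = 2) (θ₀ : R ≃ₗ[R] ⋀[R]^2 P₀)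
    (x y z w : P₀ × R) (vol : P₀ × R → P₀ × R → P₀ × R → R)
    (hvol : ∀ x y z, vol x y z =
      x.2 * chi0Bilin θ₀ y.1 z.1 - y.2 * chi0Bilin θ₀ x.1 z.1 + z.2 * chi0Bilin θ₀ x.1 y.1) :
    vol y z w • x - vol x z w • y + vol x y w • z - vol x y z • w = 0 := by
  have pl := plucker_of_rank_two hrk (chi0Bilin_self θ₀)
  have sk := skew_of_alt (chi0Bilin_self θ₀)
  obtain ⟨x, x'⟩ := x
  obtain ⟨y, y'⟩ := y
  obtain ⟨z, z'⟩ := z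
  obtain ⟨w, w'⟩ := w
  have p1 := pl x y z
  have p2 := pl x y w
  have p3 := pl x z w
  have p4 := pl y z w
  rw [sk x z] at p1
  rw [sk x w] at p2
  rw [sk x w] at p3
  rw [sk y w] at p4
  simp only [hvol]
  refine Prod.ext ?_ ?_
  · simp only [Prod.fst_add, Prod.fst_sub, Prod.smul_fst, Prod.fst_zero]
    linear_combination (norm := module) w' • p1 - z' • p2 + y' • p3 - x' • p4
  · simp only [Prod.snd_add, Prod.snd_sub, Prod.smul_snd, Prod.snd_zero, smul_eq_mul]
    ring

theorem chiBilin_bijective [Module.Finite R P₀] [Module.Projective R P₀]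
    (hrk : ∀ p : PrimeSpectrum R, Module.rankAtStalk P₀ p = 2) (θ₀ : R ≃ₗ[R] ⋀[R]^2 P₀)
    (a : (P₀ × R) →ₗ[R] R) (s : P₀ × R) (hs : a s = 1) :
    Function.Bijective (chiBilin θ₀ a s) := by
  have halt : ∀ x, chiBilin θ₀ a s x x = 0 := fun x => by
    rw [chiBilin_apply, chi0Bilin_self]; ring
  let vol : P₀ × R → P₀ × R → P₀ × R → R := fun x y z =>
    x.2 * chi0Bilin θ₀ y.1 z.1 - y.2 * chi0Bilin θ₀ x.1 z.1 + z.2 * chi0Bilin θ₀ x.1 y.1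
  have hvol : ∀ x y z, vol x y z =
    x.2 * chi0Bilin θ₀ y.1 z.1 - y.2 * chi0Bilin θ₀ x.1 z.1 + z.2 * chi0Bilin θ₀ x.1 y.1 :=
    fun _ _ _ => rfl
  have hB : ∀ x y, chiBilin θ₀ a s x y = vol x y s := fun x y => chiBilin_apply θ₀ a s x y
  have hzero : ∀ x y z : LinearMap.ker a, vol x y z = 0 := by
    intro x y z
    have h := congrArg a (cramer_four hrk θ₀ x y z s vol hvol)
    simp only [map_add, map_sub, map_smul, map_zero, LinearMap.map_coe_ker, hs, smul_eq_mul] at h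
    linear_combination -h
  refine bijective_of_plucker halt ?_ ?_
  · intro x y z
    rw [skew_of_alt halt x z, hB, hB, hB]
    refine Subtype.ext ?_
    have h := cramer_four hrk θ₀ x y z s vol hvol
    rw [hzero] at h
    simp only [Submodule.coe_add, Submodule.coe_smul, Submodule.coe_zero]
    linear_combination (norm := module) h
  · rw [eq_top_iff, ← chi0Bilin_span θ₀, Ideal.span_le]
    rintro _ ⟨p, q, rfl⟩
    let r : P₀ × R → LinearMap.ker a := fun x => ⟨x - a x • s, by simp [hs]⟩
    have hr : ∀ x, x = (r x : P₀ × R) + a x • s := fun x => by simp [r]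
    have key : ∀ u v w, vol u v w = a w * chiBilin θ₀ a s (r u) (r v)
        - a v * chiBilin θ₀ a s (r u) (r w) + a u * chiBilin θ₀ a s (r v) (r w) := by
      intro u v w
      have h0 := hzero (r u) (r v) (r w)
      have sk := skew_of_alt (chi0Bilin_self θ₀)
      have e : vol u v w = vol ((r u : P₀ × R) + a u • s) ((r v : P₀ × R) + a v • s)
          ((r w : P₀ × R) + a w • s) := by rw [← hr, ← hr, ← hr]
      rw [e, hB, hB, hB]
      simp only [hvol, Prod.fst_add, Prod.snd_add, Prod.smul_fst, Prod.smul_snd, map_add,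
        map_smul, LinearMap.add_apply, LinearMap.smul_apply, smul_eq_mul, chi0Bilin_self,
        sk (r v : P₀ × R).1 s.1, sk (r w : P₀ × R).1 s.1] at h0 ⊢
      linear_combination h0
    have e : chi0Bilin θ₀ p q = vol (p, 0) (q, 0) (0, 1) := by simp [hvol]
    have hmem : ∀ x y, chiBilin θ₀ a s x y ∈ Ideal.span {t | ∃ x y, chiBilin θ₀ a s x y = t} :=
      fun x y => Ideal.subset_span ⟨x, y, rfl⟩
    rw [SetLike.mem_coe, e, key]
    exact Ideal.add_mem _ (Ideal.sub_mem _ (Ideal.mul_mem_left _ _ (hmem _ _))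
      (Ideal.mul_mem_left _ _ (hmem _ _))) (Ideal.mul_mem_left _ _ (hmem _ _))

/-- The form `χ_a` on `P(a) = ker a`. It does not depend on the section `s` of `a`. -/
def chi [Module.Finite R P₀] [Module.Projective R P₀]
    (hrk : ∀ p : PrimeSpectrum R, Module.rankAtStalk P₀ p = 2) (θ₀ : R ≃ₗ[R] ⋀[R]^2 P₀)
    (a : (P₀ × R) →ₗ[R] R) (s : P₀ × R) (hs : a s = 1) : AltForm R (LinearMap.ker a) where
  form := chiBilin θ₀ a s
  alt x := by rw [chiBilin_apply, chi0Bilin_self]; ring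
  bij := chiBilin_bijective hrk θ₀ a s hs

/-- The isomorphism `i_s : P₀ ⊕ R → P(a) ⊕ R` given by the section `s` of `a`, which sends `x` to
`(x - a(x) s, a(x))`. -/
def sectionEquiv (a : (P₀ × R) →ₗ[R] R) (s : P₀ × R) (hs : a s = 1) :
    (P₀ × R) ≃ₗ[R] (LinearMap.ker a × R) where
  toFun x := (⟨x - a x • s, by simp [hs]⟩, a x)
  map_add' x y := by
    refine Prod.ext (Subtype.ext ?_) (map_add a x y)
    simp only [map_add, Prod.fst_add, Submodule.coe_add]
    module
  map_smul' c x := by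
    refine Prod.ext (Subtype.ext ?_) (map_smul a c x)
    simp only [map_smul, RingHom.id_apply, Prod.smul_fst, Submodule.coe_smul, smul_eq_mul]
    module
  invFun y := (y.1 : P₀ × R) + y.2 • s
  left_inv x := by simp
  right_inv y := by
    have h : a (y.1 : P₀ × R) = 0 := y.1.2
    refine Prod.ext (Subtype.ext ?_) ?_
    · simp [hs, h]
    · simp [hs, h]

/-- The form `V(a, s) = (i_s ⊕ 1)ᵗ (χ_a ⊥ ψ₂) (i_s ⊕ 1)` on `P₀ ⊕ R²`. -/
def vasersteinForm [Module.Finite R P₀] [Module.Projective R P₀]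
    (hrk : ∀ p : PrimeSpectrum R, Module.rankAtStalk P₀ p = 2) (θ₀ : R ≃ₗ[R] ⋀[R]^2 P₀)
    (a : (P₀ × R) →ₗ[R] R) (s : P₀ × R) (hs : a s = 1) : AltForm R (P₀ × R × R) :=
  ((chi hrk θ₀ a s hs).perp (psiForm R)).pullback
    ((LinearEquiv.prodAssoc R P₀ R R).symm ≪≫ₗ
      ((sectionEquiv a s hs).prodCongr (LinearEquiv.refl R R)) ≪≫ₗ
        LinearEquiv.prodAssoc R (LinearMap.ker a) R R)

end Symbol

end

end GenVaserstein

open GenVaserstein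

/-! A form on `P₄ = P₀ ⊕ R²` is determined by a linear form `a` on `P₀ ⊕ R`, namely pairing with `e₄
= (0, 0, 1)`, and an element `v` of `P₀ ⊕ R`: it is `vol(x, y, v) + a(x) y₄ - a(y) x₄`
(`exists_vol_eq`). Its Pfaffian relative to `χ₀ ⊥ ψ₂` is `a(v)` (`relPf_eq_of_vol`). Hence the forms
of relative Pfaffian `1` are exactly the forms `V(a, s)`, and a class `[P, g, f]` lies in `Ṽ(R)`
exactly when the relative Pfaffian is `1`.

The relative Pfaffian is defined for projective modules by adding a complement that makes the module
free. It is multiplicative, and pulling back along `φ` multiplies it by `det φ`. So every isometry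
between forms `V(a, s)` has determinant `1`, and every symplectic group lies in `SL`.

Changing `s` changes `V(a, s)` by a shear that fixes `e₄`, and `φ ∈ SL(P₀ ⊕ R)` acts through `φ ⊕
1`, which also fixes `e₄`. This makes the symbol well defined. Conversely, an isometry from `V(b,
t)` to `V(a, s)` that fixes `e₄` induces on `P₄ / e₄ = P₀ ⊕ R` an element of `SL` that carries `a`
to `b`. Thus `a` and `b` lie in one orbit exactly when their forms are isometric by a map fixing
`e₄`.

Equality of symbols is weaker: it makes the two forms stably isometric, since `[f] - [g]` is an
invariant of `V_SL(R)` in the Grothendieck group of symplectic modules and every symplectic module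
is a summand of a hyperbolic one. In dimension at most `4` the hyperbolic planes cancel: a height
count gives a stable range condition, which makes `Sp(F ⊥ ψ₂)` transitive on unimodular elements. So
equal symbols give an isometry `φ ∈ SL(P₄)`, and what separates this from equality of orbits is
whether an element of `Sp` moves `e₄` to `φ e₄`, which is the orbit condition. For the other
implication, the condition for `χ` and `φ` is obtained by applying injectivity to `χ` and its
pullback along `φ`. -/

namespace GenVaserstein

noncomputable section

/-! ### Pfaffians -/

section Pfaffian

variable {R : Type*} [CommRing R] {M : Type*} [AddCommGroup M] [Module R M]

/-- The Pfaffian of the Gram matrix of a family of `2n` vectors. -/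
def gramPf (B : M →ₗ[R] M →ₗ[R] R) (n : ℕ) (v : Fin (2 * n) → M) : R :=
  pf n (Matrix.of fun i j => B (v i) (v j))

theorem gramPf_succ (B : M →ₗ[R] M →ₗ[R] R) (n : ℕ) (v : Fin (2 * n + 1 + 1) → M) :
    gramPf B (n + 1) v = ∑ j : Fin (2 * n + 1), (-1) ^ (j : ℕ) * B (v 0) (v j.succ) *
      gramPf B n (fun i : Fin (2 * n) => v (j.succAbove i).succ) := rfl

/-- The expansion of the Pfaffian along a fixed first vector, as an alternating map in the other
vectors. -/
def pfExpand (B : M →ₗ[R] M →ₗ[R] R) {k : ℕ} (ω : M [⋀^Fin k]→ₗ[R] R) :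
    M →ₗ[R] M [⋀^Fin (k + 1)]→ₗ[R] R :=
  AlternatingMap.alternatizeUncurryFinLM ∘ₗ
    (LinearMap.smulRightₗ (R := R) (M₂ := M) (M := M [⋀^Fin k]→ₗ[R] R)).flip ω ∘ₗ B

theorem pfExpand_apply (B : M →ₗ[R] M →ₗ[R] R) {k : ℕ} (ω : M [⋀^Fin k]→ₗ[R] R) (x : M)
    (v : Fin (k + 1) → M) : pfExpand B ω x v =
      ∑ j : Fin (k + 1), (-1) ^ (j : ℕ) * B x (v j) * ω (j.removeNth v) := by
  simp [pfExpand, AlternatingMap.alternatizeUncurryFin_apply, mul_assoc]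

/-- The term with `B x x` drops out. Up to sign, the rest expands `ω` twice along the same linear
form `B x`, and the wedge of a linear form with itself is zero. Here this is the vanishing of the
double alternatization of the symmetric map `f`. -/
theorem pfExpand_self (B : M →ₗ[R] M →ₗ[R] R) (hB : ∀ x, B x x = 0) {k : ℕ}
    (ω : M [⋀^Fin k]→ₗ[R] R) (ω' : M [⋀^Fin (k + 2)]→ₗ[R] R)
    (h : ∀ x v, ω' (Matrix.vecCons x v) = pfExpand B ω x v) (x : M) (v : Fin (k + 2) → M) :
    pfExpand B ω' x (Matrix.vecCons x v) = 0 := by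
  let f : M →ₗ[R] M →ₗ[R] M [⋀^Fin k]→ₗ[R] R :=
    (LinearMap.smulRightₗ (R := R) (M₂ := M) (M := M →ₗ[R] M [⋀^Fin k]→ₗ[R] R) (B x))
      (LinearMap.smulRightₗ (R := R) (M₂ := M) (M := M [⋀^Fin k]→ₗ[R] R) (B x) ω)
  have hf : ∀ y z, f y z = f z y := by
    intro y z
    simp [f, smul_smul, mul_comm]
  have key := AlternatingMap.alternatizeUncurryFin_alternatizeUncurryFinLM_comp_of_symmetric hf
  have key2 := congrArg (fun t => t v) key
  simp only [AlternatingMap.alternatizeUncurryFin_apply, AlternatingMap.zero_apply] at key2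
  rw [pfExpand_apply, Fin.sum_univ_succ]
  simp only [Matrix.cons_val_zero, hB, mul_zero, zero_mul, zero_add, Matrix.cons_val_succ]
  have e : ∀ j : Fin (k + 2), (j.succ).removeNth (Matrix.vecCons x v) =
      Matrix.vecCons x (j.removeNth v) := by
    intro j
    ext i
    refine Fin.cases ?_ (fun i => ?_) i
    · simp [Fin.removeNth]
    · simp [Fin.removeNth]
  simp only [e, h, pfExpand_apply]
  rw [← neg_eq_zero, ← key2, ← Finset.sum_neg_distrib]
  refine Finset.sum_congr rfl fun j _ => ?_
  simp [f, AlternatingMap.alternatizeUncurryFin_apply, pow_succ, Finset.mul_sum, mul_assoc, mul_left_comm]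

/-- For a fixed first vector the expansion is already alternating in the others, so only a
coincidence of the first vector with another one must be excluded. A transposition moves such a
coincidence to the front. -/
theorem exists_alternating_of_pfExpand (B : M →ₗ[R] M →ₗ[R] R) {k : ℕ} (ω : M [⋀^Fin k]→ₗ[R] R)
    (h : ∀ x v, v 0 = x → pfExpand B ω x v = 0) :
    ∃ η : M [⋀^Fin (k + 2)]→ₗ[R] R, ∀ v, η v = pfExpand B ω (v 0) (fun i => v i.succ) := by
  have h' : ∀ x v i, v i = x → pfExpand B ω x v = 0 := by
    intro x v i hi
    by_cases h0 : i = 0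
    · subst h0; exact h x v hi
    · have := (pfExpand B ω x).map_swap v (Ne.symm h0)
      rw [h x _ (by simpa using hi)] at this
      simpa using this.symm
  refine ⟨{ toMultilinearMap :=
      (AlternatingMap.toMultilinearMapLM (S := R) ∘ₗ pfExpand B ω).uncurryLeft
            map_eq_zero_of_eq' := ?_ }, fun v => rfl⟩
  intro v i j hij hne
  change pfExpand B ω (v 0) (fun i => v i.succ) = 0
  induction i using Fin.cases with
  | zero =>
    induction j using Fin.cases with
    | zero => exact absurd rfl hne
    | succ j => exact h' _ _ j hij.symm
  | succ i =>
    induction j using Fin.cases with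
    | zero => exact h' _ _ i hij
    | succ j => exact (pfExpand B ω (v 0)).map_eq_zero_of_eq _ hij (by simpa using hne)

theorem exists_gramPf_alternating (B : M →ₗ[R] M →ₗ[R] R) (hB : ∀ x, B x x = 0) (n : ℕ) :
    ∃ ω : M [⋀^Fin (2 * n)]→ₗ[R] R, ∀ v, ω v = gramPf B n v := by
  -- The induction carries two consecutive Pfaffians: `pfExpand_self` for `ω'` needs that `ω'` is
  -- itself the expansion of `ω`.
  suffices H : ∃ (ω : M [⋀^Fin (2 * n)]→ₗ[R] R) (ω' : M [⋀^Fin (2 * (n + 1))]→ₗ[R] R),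
      (∀ v, ω v = gramPf B n v) ∧ (∀ v, ω' v = gramPf B (n + 1) v) by
    obtain ⟨ω, -, h, -⟩ := H
    exact ⟨ω, h⟩
  have expand : ∀ (n : ℕ) (ω : M [⋀^Fin (2 * n)]→ₗ[R] R), (∀ v, ω v = gramPf B n v) →
      ∀ v : Fin (2 * n + 1 + 1) → M,
        pfExpand B ω (v 0) (fun i => v i.succ) = gramPf B (n + 1) v := by
    intro n ω h v
    rw [pfExpand_apply, gramPf_succ]
    simp only [h]
    rfl
  induction n with
  | zero =>
    let ω : M [⋀^Fin (2 * 0)]→ₗ[R] R := @AlternatingMap.constOfIsEmpty R _ M _ _ R _ _ (Fin (2 * 0)) Fin.isEmpty 1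
    have hω : ∀ v, ω v = gramPf B 0 v := fun v => rfl
    obtain ⟨η, hη⟩ := exists_alternating_of_pfExpand B ω (by
      intro x v hx
      rw [pfExpand_apply, Fin.sum_univ_succ]
      simp [hx, hB])
    exact ⟨ω, η, hω, fun v => by rw [hη]; exact expand 0 ω hω v⟩
  | succ n ih =>
    obtain ⟨ω, ω', h, h'⟩ := ih
    obtain ⟨η, hη⟩ := exists_alternating_of_pfExpand B ω' (by
      intro x v hx
      have : v = Matrix.vecCons x (fun i => v i.succ) := by
        ext i; refine Fin.cases ?_ (fun i => ?_) i
        · simpa using hx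
        · simp
      rw [this]
      refine pfExpand_self B hB ω ω' ?_ x _
      intro x v
      rw [h', ← expand n ω h]
      rfl)
    exact ⟨ω', η, h', fun v => by rw [hη]; exact expand (n + 1) ω' h' v⟩

/-- An alternating map in as many variables as a basis has elements is a multiple of the
determinant. This is the identity `Pf(fᵗ A f) = det f · Pf A`. -/
theorem gramPf_comp_basis {B : M →ₗ[R] M →ₗ[R] R} (hB : ∀ x, B x x = 0) {n : ℕ}
    (b : Module.Basis (Fin (2 * n)) R M) (f : M →ₗ[R] M) :
    gramPf B n (fun i => f (b i)) = LinearMap.det f * gramPf B n b := by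
  obtain ⟨ω, hω⟩ := exists_gramPf_alternating B hB n
  have h := ω.eq_smul_basis_det b
  rw [← hω, ← hω]
  conv_lhs => rw [h]
  have : (fun i => f (b i)) = f ∘ b := rfl
  rw [this, AlternatingMap.smul_apply, Module.Basis.det_comp, b.det_self, smul_eq_mul, mul_one, mul_comm]

/-- The Pfaffian of the upper left corner of size `2n` of an infinite matrix. -/
def cornerPf (n : ℕ) (A : ℕ → ℕ → R) : R := pf n (Matrix.of fun i j => A i j)

theorem cornerPf_congr {n : ℕ} {A C : ℕ → ℕ → R}
    (h : ∀ i j, i < 2 * n → j < 2 * n → A i j = C i j) : cornerPf n A = cornerPf n C := by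
  rw [cornerPf, cornerPf]
  congr 1
  ext i j
  exact h i j i.2 j.2

theorem cornerPf_succ (n : ℕ) (A : ℕ → ℕ → R) : cornerPf (n + 1) A =
    ∑ j ∈ Finset.range (2 * n + 1), (-1) ^ j * A 0 (j + 1) *
      cornerPf n (fun i k => A ((if i < j then i else i + 1) + 1)
        ((if k < j then k else k + 1) + 1)) := by
  rw [Finset.sum_range, cornerPf, pf]
  refine Finset.sum_congr rfl fun (j : Fin (2 * n + 1)) _ => ?_
  have e : ∀ i : Fin (2 * n), (((j.succAbove i).succ : Fin (2 * n + 1 + 1)) : ℕ) =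
      (if (i : ℕ) < j then (i : ℕ) else i + 1) + 1 := by
    intro i
    by_cases h : (i : ℕ) < j
    · rw [Fin.succAbove_of_castSucc_lt _ _ (by simpa [Fin.lt_def] using h)]
      simp [h]
    · rw [Fin.succAbove_of_le_castSucc _ _ (by simpa [Fin.le_def] using h)]
      simp [h]
  rw [cornerPf]
  congr 2
  ext i k
  simp only [Matrix.submatrix_apply, Matrix.of_apply]
  rw [← e i, ← e k]

/-- In the expansion along the first row, the entries beyond the first block vanish, and deleting
index `0` together with another index of the first block leaves a matrix of the same shape. Indexing
by `ℕ` keeps casts between the types `Fin` out of the induction. -/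
theorem cornerPf_add (n m : ℕ) (A : ℕ → ℕ → R)
    (h : ∀ i j, i < 2 * n → 2 * n ≤ j → j < 2 * (n + m) → A i j = 0) :
    cornerPf (n + m) A = cornerPf n A * cornerPf m (fun i j => A (2 * n + i) (2 * n + j)) := by
  induction n generalizing A with
  | zero =>
    rw [zero_add]
    simp only [mul_zero, zero_add]
    exact (one_mul _).symm
  | succ n ih =>
    rw [show n + 1 + m = n + m + 1 by ring, cornerPf_succ, cornerPf_succ, Finset.sum_mul]
    rw [← Finset.sum_subset (Finset.range_mono (show 2 * n + 1 ≤ 2 * (n + m) + 1 by omega))]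
    · refine Finset.sum_congr rfl fun j hj => ?_
      rw [Finset.mem_range] at hj
      rw [ih, mul_assoc, mul_assoc, mul_assoc]
      · congr 3
        refine cornerPf_congr fun i k _ _ => ?_
        rw [if_neg (by omega), if_neg (by omega)]
        congr 1 <;> ring
      · intro i k hi hk hk'
        refine h _ _ ?_ ?_ ?_ <;> split_ifs <;> omega
    · intro j hj hj'
      rw [Finset.mem_range] at hj hj'
      rw [h 0 (j + 1) (by omega) (by omega) (by omega)]
      ring

theorem pf_eq_cornerPf (n : ℕ) (A : Matrix (Fin (2 * n)) (Fin (2 * n)) R) (C : ℕ → ℕ → R)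
    (h : ∀ i j : Fin (2 * n), A i j = C i j) : pf n A = cornerPf n C := by
  rw [cornerPf]
  congr 1
  ext i j
  exact h i j

/-- The Pfaffian of a block diagonal matrix. -/
theorem pf_blocks {n m : ℕ} (A : Matrix (Fin (2 * n)) (Fin (2 * n)) R)
    (C : Matrix (Fin (2 * m)) (Fin (2 * m)) R)
    (e : Fin (2 * n) ⊕ Fin (2 * m) ≃ Fin (2 * (n + m)))
    (he : ∀ i, (e (Sum.inl i) : ℕ) = i) (he' : ∀ i, (e (Sum.inr i) : ℕ) = 2 * n + i)
    (D : Matrix (Fin (2 * (n + m))) (Fin (2 * (n + m))) R)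
    (h₁ : ∀ i j, D (e (Sum.inl i)) (e (Sum.inl j)) = A i j)
    (h₂ : ∀ i j, D (e (Sum.inl i)) (e (Sum.inr j)) = 0)
    (h₃ : ∀ i j, D (e (Sum.inr i)) (e (Sum.inr j)) = C i j) : pf (n + m) D = pf n A * pf m C := by
  let D' : ℕ → ℕ → R := fun i j =>
    if h : i < 2 * (n + m) ∧ j < 2 * (n + m) then D ⟨i, h.1⟩ ⟨j, h.2⟩ else 0
  have hl : ∀ (i : ℕ) (h : i < 2 * n) (h' : i < 2 * (n + m)), (⟨i, h'⟩ : Fin (2 * (n + m))) = e (Sum.inl ⟨i, h⟩) :=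
    fun i h _ => Fin.ext (he ⟨i, h⟩).symm
  have hr : ∀ (i : ℕ) (h : i < 2 * m) (h' : 2 * n + i < 2 * (n + m)),
      (⟨2 * n + i, h'⟩ : Fin (2 * (n + m))) = e (Sum.inr ⟨i, h⟩) :=
    fun i h _ => Fin.ext (he' ⟨i, h⟩).symm
  rw [pf_eq_cornerPf (n + m) D D' (fun i j => by simp [D']), cornerPf_add]
  · congr 1
    · refine (pf_eq_cornerPf n A _ fun i j => ?_).symm
      have hi := i.2
      have hj := j.2
      simp only [D']
      rw [dif_pos (by omega), hl _ hi, hl _ hj, h₁]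
    · refine (pf_eq_cornerPf m C _ fun i j => ?_).symm
      have hi := i.2
      have hj := j.2
      simp only [D']
      rw [dif_pos (by omega), hr _ hi, hr _ hj, h₃]
  · intro i j hi hj hj'
    obtain ⟨k, rfl⟩ := Nat.exists_eq_add_of_le hj
    simp only [D']
    rw [dif_pos (by omega), hl _ hi, hr k (by omega), h₂]

/-- The bijection between the disjoint union of two even blocks and one even block. -/
def evenBlocks (n m : ℕ) : Fin (2 * n) ⊕ Fin (2 * m) ≃ Fin (2 * (n + m)) :=
  finSumFinEquiv.trans (finCongr (by ring))

theorem evenBlocks_inl (n m : ℕ) (i : Fin (2 * n)) : (evenBlocks n m (Sum.inl i) : ℕ) = i := by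
  simp [evenBlocks]

theorem evenBlocks_inr (n m : ℕ) (i : Fin (2 * m)) :
    (evenBlocks n m (Sum.inr i) : ℕ) = 2 * n + i := by
  simp [evenBlocks]

theorem pf_psi2 : pf 1 (psi2 R) = 1 := by
  simp [pf, psi2]

theorem pf_psi (n : ℕ) : pf n (psi R n) = 1 := by
  induction n with
  | zero => rfl
  | succ n ih =>
    rw [pf_blocks (psi R n) (psi2 R) (evenBlocks n 1) (evenBlocks_inl n 1) (evenBlocks_inr n 1),
      ih, pf_psi2, one_mul]
    all_goals
      intro i j
      simp [psi, evenBlocks]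

end Pfaffian

/-! ### The monoid of isometry classes of symplectic modules -/

section Isometry

variable {R : Type u} [CommRing R]

namespace AltForm

variable {M N L : Type*} [AddCommGroup M] [Module R M] [AddCommGroup N] [Module R N]
  [AddCommGroup L] [Module R L]

theorem ext_form {f g : AltForm R M} (h : ∀ x y, f.form x y = g.form x y) : f = g := by
  cases f; cases g
  congr
  exact LinearMap.ext₂ h

theorem skew (f : AltForm R M) (x y : M) : f.form y x = -f.form x y := skew_of_alt f.alt x y

@[simp]
theorem pullback_apply (f : AltForm R N) (h : M ≃ₗ[R] N) (x y : M) :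
    (f.pullback h).form x y = f.form (h x) (h y) := rfl

@[simp]
theorem perp_apply (f : AltForm R M) (g : AltForm R N) (x y : M × N) :
    (f.perp g).form x y = f.form x.1 y.1 + g.form x.2 y.2 := rfl

/-- Isometry of non-degenerate alternating forms. -/
def Isometric (f : AltForm R M) (g : AltForm R N) : Prop :=
  ∃ e : M ≃ₗ[R] N, ∀ x y, f.form x y = g.form (e x) (e y)

theorem Isometric.refl (f : AltForm R M) : f.Isometric f :=
  ⟨LinearEquiv.refl R M, fun _ _ => rfl⟩

theorem Isometric.symm {f : AltForm R M} {g : AltForm R N} :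
    f.Isometric g → g.Isometric f := by
  rintro ⟨e, h⟩
  exact ⟨e.symm, fun x y => by simp [h]⟩

theorem Isometric.trans {f : AltForm R M} {g : AltForm R N} {k : AltForm R L} :
    f.Isometric g → g.Isometric k → f.Isometric k := by
  rintro ⟨e, h⟩ ⟨e', h'⟩
  exact ⟨e.trans e', fun x y => by simp [h, h']⟩

/-- The unique form on a trivial module. -/
def ofSubsingleton [Subsingleton M] : AltForm R M where
  form := 0
  alt _ := rfl
  bij := ⟨fun _ _ _ => Subsingleton.elim _ _, fun l => ⟨0, LinearMap.ext fun x => by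
    rw [Subsingleton.elim x 0]; simp⟩⟩

/-- The orthogonal sum of `m` copies of a form. -/
def power (f : AltForm R M) (m : ℕ) : AltForm R (Fin m → M) where
  form := ∑ k, f.form.compl₁₂ (LinearMap.proj k) (LinearMap.proj k)
  alt x := by simp [f.alt]
  bij := by
    constructor
    · intro x y hxy
      ext k
      refine f.bij.1 (LinearMap.ext fun z => ?_)
      have h := LinearMap.congr_fun hxy (Pi.single k z)
      simp only [LinearMap.sum_apply, LinearMap.compl₁₂_apply, LinearMap.proj_apply] at h
      rwa [Finset.sum_eq_single k, Finset.sum_eq_single k, Pi.single_eq_same] at h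
      all_goals simp +contextual
    · intro l
      choose z hz using fun k => f.bij.2 (l ∘ₗ LinearMap.single R (fun _ => M) k)
      refine ⟨z, LinearMap.pi_ext' fun k => LinearMap.ext fun y => ?_⟩
      have h := LinearMap.congr_fun (hz k) y
      simp only [LinearMap.comp_apply, LinearMap.sum_apply, LinearMap.compl₁₂_apply,
        LinearMap.proj_apply, LinearMap.coe_single] at h ⊢
      rw [← h, Finset.sum_eq_single k, Pi.single_eq_same]
      all_goals simp +contextual

theorem power_apply (f : AltForm R M) (m : ℕ) (x y : Fin m → M) :
    (f.power m).form x y = ∑ k, f.form (x k) (y k) := by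
  simp [power]

end AltForm

variable (R) in
/-- Finitely generated projective modules with a non-degenerate alternating form. -/
structure SympMod where
  carrier : Type u
  [grp : AddCommGroup carrier]
  [mod : Module R carrier]
  [fin : Module.Finite R carrier]
  [proj : Module.Projective R carrier]
  form : AltForm R carrier

attribute [instance] SympMod.grp SympMod.mod SympMod.fin SympMod.proj

variable (R) in
/-- Isometry of symplectic modules. -/
def sympSetoid : Setoid (SympMod R) where
  r S T := S.form.Isometric T.form
  iseqv := ⟨fun _ => .refl _, .symm, .trans⟩

variable (R) in
/-- Isometry classes of symplectic modules. -/
def SympClass : Type (u + 1) := Quotient (sympSetoid R)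

variable {P Q P' : Type u} [AddCommGroup P] [Module R P] [Module.Finite R P] [Module.Projective R P]
  [AddCommGroup Q] [Module R Q] [Module.Finite R Q] [Module.Projective R Q]
  [AddCommGroup P'] [Module R P'] [Module.Finite R P'] [Module.Projective R P']

/-- The isometry class of a form. -/
def SympClass.mk (f : AltForm R P) : SympClass R := Quotient.mk (sympSetoid R) ⟨P, f⟩

theorem SympClass.mk_eq_iff {f : AltForm R P} {g : AltForm R Q} :
    SympClass.mk f = SympClass.mk g ↔ f.Isometric g :=
  Quotient.eq (r := sympSetoid R)

theorem SympClass.exists_rep (x : SympClass R) : ∃ (Q : Type u) (_ : AddCommGroup Q)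
    (_ : Module R Q) (_ : Module.Finite R Q) (_ : Module.Projective R Q) (h : AltForm R Q),
    x = SympClass.mk h := by
  induction x using Quotient.inductionOn with
  | _ S => exact ⟨S.carrier, _, _, inferInstance, inferInstance, S.form, rfl⟩

instance : Add (SympClass R) where
  add := Quotient.map₂ (fun S T => ⟨S.carrier × T.carrier, S.form.perp T.form⟩) (by
    rintro S S' ⟨e, h⟩ T T' ⟨e', h'⟩
    exact ⟨e.prodCongr e', fun x y => by simp [h, h']⟩)

theorem SympClass.mk_perp (f : AltForm R P) (g : AltForm R Q) :
    SympClass.mk (f.perp g) = SympClass.mk f + SympClass.mk g := rfl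

instance : Zero (SympClass R) where
  zero := SympClass.mk (AltForm.ofSubsingleton (M := PUnit))

theorem SympClass.mk_of_subsingleton [Subsingleton P] (f : AltForm R P) : SympClass.mk f = 0 :=
  SympClass.mk_eq_iff.2 ⟨{ (0 : P →ₗ[R] PUnit.{u + 1}) with
    invFun := 0
    left_inv := fun _ => Subsingleton.elim _ _
    right_inv := fun _ => rfl }, fun x y => by rw [Subsingleton.elim x 0]; simp [AltForm.ofSubsingleton]⟩

instance : AddCommMonoid (SympClass R) where
  add_assoc x y z := by
    obtain ⟨X, _, _, _, _, f, rfl⟩ := x.exists_rep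
    obtain ⟨Y, _, _, _, _, g, rfl⟩ := y.exists_rep
    obtain ⟨Z, _, _, _, _, h, rfl⟩ := z.exists_rep
    simp only [← SympClass.mk_perp]
    exact SympClass.mk_eq_iff.2 ⟨LinearEquiv.prodAssoc R X Y Z, fun x y => by simp [add_assoc]⟩
  add_comm x y := by
    obtain ⟨X, _, _, _, _, f, rfl⟩ := x.exists_rep
    obtain ⟨Y, _, _, _, _, g, rfl⟩ := y.exists_rep
    simp only [← SympClass.mk_perp]
    exact SympClass.mk_eq_iff.2 ⟨LinearEquiv.prodComm R X Y, fun x y => by simp [add_comm]⟩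
  zero_add x := by
    obtain ⟨X, _, _, _, _, f, rfl⟩ := x.exists_rep
    change SympClass.mk _ + _ = _
    rw [← SympClass.mk_perp]
    exact SympClass.mk_eq_iff.2 ⟨LinearEquiv.uniqueProd, fun x y => by
      simp [AltForm.ofSubsingleton]⟩
  add_zero x := by
    obtain ⟨X, _, _, _, _, f, rfl⟩ := x.exists_rep
    change _ + SympClass.mk _ = _
    rw [← SympClass.mk_perp]
    exact SympClass.mk_eq_iff.2 ⟨LinearEquiv.prodUnique, fun x y => by
      simp [AltForm.ofSubsingleton]⟩
  nsmul := nsmulRec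

instance projective_pi (m : ℕ) : Module.Projective R (Fin m → P) :=
  .of_equiv (DFinsupp.linearEquivFunOnFintype (R := R) (M := fun _ : Fin m => P))

theorem SympClass.mk_power (f : AltForm R P) (m : ℕ) :
    SympClass.mk (f.power m) = m • SympClass.mk f := by
  induction m with
  | zero => rw [zero_smul]; exact SympClass.mk_of_subsingleton _
  | succ m ih =>
    rw [succ_nsmul', ← ih, ← SympClass.mk_perp]
    refine (SympClass.mk_eq_iff.2 ⟨Fin.consLinearEquiv R (fun _ => P), fun x y => ?_⟩).symm
    simp [AltForm.power_apply, Fin.sum_univ_succ]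

theorem AltForm.ofMatrix_apply {n : ℕ} (A : Matrix (Fin n) (Fin n) R)
    (hA : IsAlternatingInvertible A) (x y : Fin n → R) :
    (AltForm.ofMatrix A hA).form x y = x ⬝ᵥ A.mulVec y :=
  Matrix.toLinearMap₂'_apply' _ _ _

theorem SympClass.mk_psi (n : ℕ) :
    SympClass.mk (AltForm.ofMatrix (psi R n) (psi_isAlternatingInvertible n)) =
      n • SympClass.mk (psiForm R) := by
  induction n with
  | zero =>
    rw [zero_smul]
    have : Subsingleton (Fin (2 * 0) → R) := inferInstanceAs (Subsingleton (Fin 0 → R))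
    exact SympClass.mk_of_subsingleton _
  | succ n ih =>
    rw [succ_nsmul, ← ih, ← SympClass.mk_perp]
    refine SympClass.mk_eq_iff.2 ⟨LinearEquiv.funCongrLeft R R (finSumFinEquiv (m := 2 * n) (n := 2))
      ≪≫ₗ LinearEquiv.sumArrowLequivProdArrow _ _ R R ≪≫ₗ
      (LinearEquiv.refl R _).prodCongr (LinearEquiv.finTwoArrow R R), fun x y => ?_⟩
    have key : ∀ z : Fin (2 * n + 2) → R, z ∘ (finSumFinEquiv (m := 2 * n) (n := 2)) =
        Sum.elim (fun i => z (finSumFinEquiv (Sum.inl i))) (fun i => z (finSumFinEquiv (Sum.inr i))) :=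
      fun z => by ext (i | i) <;> rfl
    have h1 : (AltForm.ofMatrix (psi R (n + 1)) (psi_isAlternatingInvertible (n + 1))).form x y =
        (x ∘ (finSumFinEquiv (m := 2 * n) (n := 2))) ⬝ᵥ
          (Matrix.fromBlocks (psi R n) 0 0 (psi2 R)).mulVec
            (y ∘ (finSumFinEquiv (m := 2 * n) (n := 2))) := by
      rw [AltForm.ofMatrix_apply, psi, Matrix.submatrix_mulVec_equiv]
      exact (comp_equiv_dotProduct_comp_equiv _ _ (finSumFinEquiv (m := 2 * n) (n := 2))).symm.trans
        (by congr 1; ext; simp)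
    rw [h1, key, key, Matrix.fromBlocks_mulVec, sumElim_dotProduct_sumElim, AltForm.perp_apply,
      AltForm.ofMatrix_apply, psiForm_apply]
    congr 1
    · simp [Function.comp_def]; rfl
    · simp [psi2, Function.comp_def, dotProduct, Fin.sum_univ_two, ← sub_eq_add_neg]
      rfl

/-- A non-degenerate submodule is an orthogonal summand. -/
theorem SympClass.exists_add_of_embedding (F : AltForm R P) (g : AltForm R P')
    (ι : P' →ₗ[R] P) (hι : ∀ x y, F.form (ι x) (ι y) = g.form x y) :
    ∃ z, SympClass.mk F = SympClass.mk g + z := by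
  let γ : P' ≃ₗ[R] Module.Dual R P' := LinearEquiv.ofBijective g.form g.bij
  -- `ρ` is the adjoint of `ι`. It is a retraction of `ι` whose kernel is the orthogonal complement
  -- of the image.
  let ρ : P →ₗ[R] P' := γ.symm ∘ₗ (LinearMap.lcomp R R ι) ∘ₗ F.form
  have hρ : ∀ z x, g.form (ρ z) x = F.form z (ι x) := fun z x => by
    have : γ (ρ z) = (LinearMap.lcomp R R ι) (F.form z) := γ.apply_symm_apply _
    exact LinearMap.congr_fun this x
  have hρι : ∀ x, ρ (ι x) = x := fun x => g.bij.1 (LinearMap.ext fun y => by rw [hρ, hι])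
  let Q := LinearMap.ker ρ
  let π : P →ₗ[R] Q := (LinearMap.id - ι ∘ₗ ρ).codRestrict Q fun z => by simp [Q, hρι]
  have hπ : ∀ q : Q, π q = q := fun q => Subtype.ext (by
    have : ρ q = 0 := q.2
    simp [π, this])
  have hz : ∀ z, z = ι (ρ z) + (π z : P) := fun z => by simp [π]
  have : Module.Finite R Q := Module.Finite.of_surjective π fun q => ⟨q, hπ q⟩
  have : Module.Projective R Q := Module.Projective.of_split Q.subtype π (LinearMap.ext hπ)
  have orth : ∀ (q : Q) x, F.form q (ι x) = 0 := fun q x => by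
    have : ρ q = 0 := q.2
    rw [← hρ, this]; simp
  have orth' : ∀ (q : Q) x, F.form (ι x) q = 0 := fun q x => by rw [F.skew, orth, neg_zero]
  let h : AltForm R Q :=
    { form := F.form.compl₁₂ Q.subtype Q.subtype
      alt := fun x => F.alt x
      bij := by
        constructor
        · intro x y hxy
          refine Subtype.ext (F.bij.1 (LinearMap.ext fun z => ?_))
          have := LinearMap.congr_fun hxy (π z)
          simp only [LinearMap.compl₁₂_apply, Submodule.subtype_apply] at this
          rw [hz z, map_add, map_add, orth, orth, this]
        · intro l
          obtain ⟨w, hw⟩ := F.bij.2 (l ∘ₗ π)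
          refine ⟨π w, LinearMap.ext fun q => ?_⟩
          have := LinearMap.congr_fun hw q
          rw [hz w] at this
          simpa [orth', hπ] using this }
  refine ⟨SympClass.mk h, ?_⟩
  rw [← SympClass.mk_perp]
  refine SympClass.mk_eq_iff.2 ⟨{ ρ.prod π with
    invFun := fun y => ι y.1 + y.2
    left_inv := fun z => (hz z).symm
    right_inv := fun y => by
      have : ρ y.2 = 0 := y.2.2
      refine Prod.ext ?_ ?_
      · simp [hρι, this]
      · have h0 : π (ι y.1) = 0 := Subtype.ext (by simp [π, hρι])
        simp [h0, hπ] }, fun x y => ?_⟩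
  change F.form x y = g.form (ρ x) (ρ y) + F.form (π x) (π y)
  conv_lhs => rw [hz x, hz y]
  simp [orth, orth', hι]

/-- Every symplectic module is an orthogonal summand of a hyperbolic space. -/
theorem SympClass.exists_complement (x : SympClass R) :
    ∃ (y : SympClass R) (m : ℕ), x + y = m • SympClass.mk (psiForm R) := by
  obtain ⟨P, _, _, _, _, g, rfl⟩ := x.exists_rep
  obtain ⟨m, π, i, -, -, hi⟩ := Module.Finite.exists_comp_eq_id_of_projective R P
  have hi' : ∀ x, π (i x) = x := fun x => LinearMap.congr_fun hi x
  let G : Fin m → Fin m → R := fun k l => g.form (π (Pi.single k 1)) (π (Pi.single l 1))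
  -- The strictly upper triangular part writes an alternating matrix as `U - Uᵗ` without division by
  -- `2`.
  let U : Matrix (Fin m) (Fin m) R := Matrix.of fun k l => if k < l then G k l else 0
  have hG : ∀ k l, G k l = U k l - U l k := by
    intro k l
    simp only [U, Matrix.of_apply]
    rcases lt_trichotomy k l with h | h | h
    · simp [h, h.not_gt]
    · subst h; simp [G, g.alt]
    · have : G k l = - G l k := g.skew _ _
      simp [h.not_gt, h, this]
  -- The hyperbolic form of `(p, U p)` and `(q, U q)` is `pᵗ U q - qᵗ U p`, which is the form of `U
  -- - Uᵗ`.
  let ι : P →ₗ[R] (Fin m → R × R) :=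
    LinearMap.pi fun k => (LinearMap.proj k ∘ₗ i).prod (LinearMap.proj k ∘ₗ U.mulVecLin ∘ₗ i)
  obtain ⟨z, hz⟩ := SympClass.exists_add_of_embedding ((psiForm R).power m) g ι (by
    intro x y
    have h : g.form x y = i x ⬝ᵥ (U - U.transpose).mulVec (i y) := by
      have e : ∀ x, x = π (∑ k, i x k • Pi.single k 1) := fun x => by
        rw [← pi_eq_sum_univ', hi']
      conv_lhs => rw [e x, e y]
      simp only [map_sum, map_smul, LinearMap.sum_apply, LinearMap.smul_apply, dotProduct,
        Matrix.mulVec, Finset.mul_sum, smul_eq_mul]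
      rw [Finset.sum_comm]
      refine Finset.sum_congr rfl fun k _ => Finset.sum_congr rfl fun l _ => ?_
      have := hG k l
      simp only [G] at this
      rw [this, Matrix.sub_apply, Matrix.transpose_apply]
      ring
    rw [h, Matrix.sub_mulVec, dotProduct_sub, AltForm.power_apply, Matrix.mulVec_transpose,
      dotProduct_comm (i x) (Matrix.vecMul _ _), ← Matrix.dotProduct_mulVec,
      dotProduct_comm (i y)]
    simp only [psiForm_apply, dotProduct, ← Finset.sum_sub_distrib]
    rfl)
  exact ⟨z, m, by rw [← hz, SympClass.mk_power]⟩

end Isometry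

/-! ### The relative Pfaffian of two forms on a projective module -/

section GramPf

variable {R : Type*} [CommRing R] {M N P Q P' Q' : Type*} [AddCommGroup M] [Module R M]
  [AddCommGroup N] [Module R N] [AddCommGroup P] [Module R P] [AddCommGroup Q] [Module R Q]
  [AddCommGroup P'] [Module R P'] [AddCommGroup Q'] [Module R Q']

/-- The orthogonal sum of bilinear forms. -/
def perpBilin (B : M →ₗ[R] M →ₗ[R] R) (C : N →ₗ[R] N →ₗ[R] R) : M × N →ₗ[R] M × N →ₗ[R] R :=
  B.compl₁₂ (LinearMap.fst R M N) (LinearMap.fst R M N) +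
    C.compl₁₂ (LinearMap.snd R M N) (LinearMap.snd R M N)

@[simp]
theorem perpBilin_apply (B : M →ₗ[R] M →ₗ[R] R) (C : N →ₗ[R] N →ₗ[R] R) (x y : M × N) :
    perpBilin B C x y = B x.1 y.1 + C x.2 y.2 := rfl

theorem gramPf_congr {B : M →ₗ[R] M →ₗ[R] R} {C : N →ₗ[R] N →ₗ[R] R} {n : ℕ}
    {v : Fin (2 * n) → M} {w : Fin (2 * n) → N} (h : ∀ i j, B (v i) (v j) = C (w i) (w j)) :
    gramPf B n v = gramPf C n w := by
  rw [gramPf, gramPf]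
  congr 1
  ext i j
  exact h i j

/-- The basis of a product given by two bases with an even number of elements. -/
def prodBasis {n m : ℕ} (β : Module.Basis (Fin (2 * n)) R M) (β' : Module.Basis (Fin (2 * m)) R N) :
    Module.Basis (Fin (2 * (n + m))) R (M × N) :=
  (β.prod β').reindex (evenBlocks n m)

theorem gramPf_prodBasis (B : M →ₗ[R] M →ₗ[R] R) (C : N →ₗ[R] N →ₗ[R] R) {n m : ℕ}
    (β : Module.Basis (Fin (2 * n)) R M) (β' : Module.Basis (Fin (2 * m)) R N) :
    gramPf (perpBilin B C) (n + m) (prodBasis β β') = gramPf B n β * gramPf C m β' := by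
  refine pf_blocks _ _ (evenBlocks n m) (evenBlocks_inl n m) (evenBlocks_inr n m) _ ?_ ?_ ?_ <;>
    intro i j <;> simp [prodBasis]

/-- Exchanging two summands up to the factor `u`, by maps `b` and `c` with `b c = u` and
`c b = u`. -/
def exchange (b : P' →ₗ[R] P) (c : P →ₗ[R] P') : ((P × Q) × (P' × Q')) →ₗ[R] ((P × Q) × (P' × Q')) :=
  ((b ∘ₗ LinearMap.fst R P' Q' ∘ₗ LinearMap.snd R _ _).prod
    (LinearMap.snd R P Q ∘ₗ LinearMap.fst R _ _)).prod
  ((c ∘ₗ LinearMap.fst R P Q ∘ₗ LinearMap.fst R _ _).prod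
    (LinearMap.snd R P' Q' ∘ₗ LinearMap.snd R _ _))

@[simp]
theorem exchange_apply (b : P' →ₗ[R] P) (c : P →ₗ[R] P') (x : (P × Q) × (P' × Q')) :
    exchange b c x = ((b x.2.1, x.1.2), (c x.1.1, x.2.2)) := rfl

/-- Exchanging twice multiplies `P` and `P'` by `u` and is the identity on `Q` and `Q'`. The map `τ`
supplies the missing factors, so the composite is the scalar `u`. -/
theorem exists_det_exchange_dvd_pow [Module.Free R (P × Q)] [Module.Finite R (P × Q)]
    [Module.Free R (P' × Q')] [Module.Finite R (P' × Q')] (b : P' →ₗ[R] P) (c : P →ₗ[R] P') (u : R)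
    (hbc : ∀ x, b (c x) = u • x) (hcb : ∀ x, c (b x) = u • x) :
    ∃ N : ℕ, LinearMap.det (exchange (Q := Q) (Q' := Q') b c) ∣ u ^ N := by
  let τ : ((P × Q) × (P' × Q')) →ₗ[R] ((P × Q) × (P' × Q')) :=
    (LinearMap.id.prodMap (u • LinearMap.id)).prodMap (LinearMap.id.prodMap (u • LinearMap.id))
  have h : exchange b c ∘ₗ (exchange b c ∘ₗ τ) = u • LinearMap.id := by
    refine LinearMap.ext fun x => ?_
    simp [τ, hbc, hcb]
    rfl
  have h' := congrArg LinearMap.det h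
  rw [LinearMap.det_comp, LinearMap.det_smul, LinearMap.det_id, mul_one] at h'
  exact ⟨_, Dvd.intro _ h'⟩

/-- The pullback of `(f ⊥ h) ⊥ (k ⊥ h')` along the exchange is `(cᵗ k c ⊥ h) ⊥ (bᵗ f b ⊥ h')`, so
the two products of Pfaffians differ by its determinant. -/
theorem gramPf_exchange {n m : ℕ} (β : Module.Basis (Fin (2 * n)) R (P × Q))
    (β' : Module.Basis (Fin (2 * m)) R (P' × Q')) (b : P' →ₗ[R] P) (c : P →ₗ[R] P')
    {f : P →ₗ[R] P →ₗ[R] R} {h : Q →ₗ[R] Q →ₗ[R] R} {k : P' →ₗ[R] P' →ₗ[R] R}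
    {h' : Q' →ₗ[R] Q' →ₗ[R] R} (hf : ∀ x, f x x = 0) (hh : ∀ x, h x x = 0) (hk : ∀ x, k x x = 0)
    (hh' : ∀ x, h' x x = 0) :
    LinearMap.det (exchange (Q := Q) (Q' := Q') b c) *
        (gramPf (perpBilin f h) n β * gramPf (perpBilin k h') m β') =
      gramPf (perpBilin (k.compl₁₂ c c) h) n β * gramPf (perpBilin (f.compl₁₂ b b) h') m β' := by
  rw [← gramPf_prodBasis, ← gramPf_prodBasis, ← gramPf_comp_basis (by simp [hf, hh, hk, hh'])]
  refine gramPf_congr fun i j => ?_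
  simp only [exchange_apply, perpBilin_apply, LinearMap.compl₁₂_apply]
  ring

/-- The ratio of the Pfaffians of two forms can be computed on any module that is isomorphic to the
given one up to the factor `u`. -/
theorem exists_pow_mul_gramPf_eq {n m : ℕ} (β : Module.Basis (Fin (2 * n)) R (P × Q))
    (β' : Module.Basis (Fin (2 * m)) R (P' × Q')) (b : P' →ₗ[R] P) (c : P →ₗ[R] P') (u : R)
    (hbc : ∀ x, b (c x) = u • x) (hcb : ∀ x, c (b x) = u • x)
    {f g : P →ₗ[R] P →ₗ[R] R} {h : Q →ₗ[R] Q →ₗ[R] R} {k : P' →ₗ[R] P' →ₗ[R] R}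
    {h' : Q' →ₗ[R] Q' →ₗ[R] R} (hf : ∀ x, f x x = 0) (hg : ∀ x, g x x = 0) (hh : ∀ x, h x x = 0)
    (hk : ∀ x, k x x = 0) (hh' : ∀ x, h' x x = 0) (hu : gramPf (perpBilin k h') m β' = 1) :
    ∃ N : ℕ, u ^ N *
        (gramPf (perpBilin f h) n β * gramPf (perpBilin (g.compl₁₂ b b) h') m β') =
      u ^ N * (gramPf (perpBilin g h) n β * gramPf (perpBilin (f.compl₁₂ b b) h') m β') := by
  have := Module.Free.of_basis β
  have := Module.Free.of_basis β'
  have := Module.Finite.of_basis β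
  have := Module.Finite.of_basis β'
  -- The factor involving `cᵗ k c` is the same in the identities for `f` and `g`, so it disappears
  -- on cross-multiplication and need not be invertible. The determinant that remains divides a
  -- power of `u`.
  obtain ⟨N, z, hz⟩ := exists_det_exchange_dvd_pow (Q := Q) (Q' := Q') b c u hbc hcb
  have e1 := gramPf_exchange β β' b c hf hh hk hh'
  have e2 := gramPf_exchange β β' b c hg hh hk hh'
  rw [hu, mul_one] at e1 e2
  refine ⟨N, ?_⟩
  rw [hz]
  linear_combination z * gramPf (perpBilin (g.compl₁₂ b b) h') m β' * e1 -
    z * gramPf (perpBilin (f.compl₁₂ b b) h') m β' * e2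

end GramPf

/-! ### Independence, multiplicativity and the description of `Ṽ(R)` by relative Pfaffians. -/

section RelativePfaffian

variable {R : Type u} [CommRing R] {P P' : Type u} [AddCommGroup P] [Module R P]
  [AddCommGroup P'] [Module R P']

/-- `r` is the Pfaffian of `f` relative to `g`: after adding a form `h` such that the module
becomes free and `g ⊥ h` has Pfaffian `1` with respect to some basis, `f ⊥ h` has Pfaffian `r` with
respect to this basis. -/
def IsRelPf (g f : AltForm R P) (r : R) : Prop :=
  ∃ (Q : Type u) (_ : AddCommGroup Q) (_ : Module R Q) (h : AltForm R Q) (n : ℕ)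
    (β : Module.Basis (Fin (2 * n)) R (P × Q)),
    gramPf (perpBilin g.form h.form) n β = 1 ∧ gramPf (perpBilin f.form h.form) n β = r

/-- Exchanging `P` with itself by the identity, so `u = 1`, shows that the ratio of the Pfaffians of
two forms does not depend on the complement or the basis. All three ratios can then be read off from
one choice. Uniqueness of the relative Pfaffian is a special case. -/
theorem IsRelPf.chain {g f k : AltForm R P} {r s t : R} (h₁ : IsRelPf g f r) (h₂ : IsRelPf f k s)
    (h₃ : IsRelPf g k t) : t = r * s := by
  have key : ∀ {f k : AltForm R P} {s : R}, IsRelPf f k s → ∀ (Q : Type u) (_ : AddCommGroup Q)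
      (_ : Module R Q) (h : AltForm R Q) (n : ℕ) (β : Module.Basis (Fin (2 * n)) R (P × Q)),
      gramPf (perpBilin k.form h.form) n β = gramPf (perpBilin f.form h.form) n β * s := by
    rintro f k s ⟨Q', _, _, h', m, β', h1, h2⟩ Q _ _ h n β
    obtain ⟨N, hN⟩ := exists_pow_mul_gramPf_eq β β' LinearMap.id LinearMap.id 1 (by simp) (by simp)
      (f := k.form) (g := f.form) (h := h.form) (k := f.form) (h' := h'.form)
      k.alt f.alt h.alt f.alt h'.alt h1
    simp only [one_pow, one_mul, LinearMap.compl₁₂_id_id] at hN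
    rw [h1, h2, mul_one] at hN
    exact hN
  obtain ⟨Q, _, _, h, n, β, e1, e2⟩ := h₁
  have a1 := key h₂ Q _ _ h n β
  have a2 := key h₃ Q _ _ h n β
  rw [e2] at a1
  rw [e1, one_mul] at a2
  rw [← a2, a1]

theorem IsRelPf.self {g f : AltForm R P} {r : R} (h : IsRelPf g f r) : IsRelPf g g 1 := by
  obtain ⟨Q, _, _, h, n, β, e1, -⟩ := h
  exact ⟨Q, _, _, h, n, β, e1, e1⟩

theorem IsRelPf.unique {g f : AltForm R P} {r s : R} (h₁ : IsRelPf g f r) (h₂ : IsRelPf g f s) :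
    r = s := by
  simpa using h₁.self.chain h₂ h₁

theorem IsRelPf.of_isometry {g f : AltForm R P} {g' f' : AltForm R P'} {r : R} (e : P ≃ₗ[R] P')
    (hg : ∀ x y, g.form x y = g'.form (e x) (e y)) (hf : ∀ x y, f.form x y = f'.form (e x) (e y))
    (h : IsRelPf g f r) : IsRelPf g' f' r := by
  obtain ⟨Q, _, _, h, n, β, e1, e2⟩ := h
  refine ⟨Q, _, _, h, n, β.map (e.prodCongr (LinearEquiv.refl R Q)), ?_, ?_⟩
  · rw [← e1]
    exact gramPf_congr fun i j => by simp [hg]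
  · rw [← e2]
    exact gramPf_congr fun i j => by simp [hf]

theorem IsRelPf.perp {g f : AltForm R P} {g' f' : AltForm R P'} {r r' : R} (h₁ : IsRelPf g f r)
    (h₂ : IsRelPf g' f' r') : IsRelPf (g.perp g') (f.perp f') (r * r') := by
  obtain ⟨Q, _, _, h, n, β, e1, e2⟩ := h₁
  obtain ⟨Q', _, _, h', n', β', e1', e2'⟩ := h₂
  refine ⟨Q × Q', _, _, h.perp h', n + n',
    (prodBasis β β').map (LinearEquiv.prodProdProdComm R P Q P' Q'), ?_, ?_⟩
  · rw [← mul_one 1]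
    nth_rewrite 1 [← e1]
    rw [← e1', ← gramPf_prodBasis]
    exact gramPf_congr fun i j => add_add_add_comm _ _ _ _
  · rw [← e2, ← e2', ← gramPf_prodBasis]
    exact gramPf_congr fun i j => add_add_add_comm _ _ _ _

/-- As `P × Q` is free, the determinant of `φ` is that of `φ ⊕ id` on `P × Q`, and
`gramPf_comp_basis` applies to it. -/
theorem IsRelPf.pullback [Module.Finite R P] [Module.Projective R P] {g f : AltForm R P} {r : R}
    (φ : P ≃ₗ[R] P) (h : IsRelPf g f r) :
    IsRelPf g (f.pullback φ) (pdet R P (φ : P →ₗ[R] P) * r) := by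
  obtain ⟨Q, _, _, h, n, β, e1, e2⟩ := h
  refine ⟨Q, _, _, h, n, β, e1, ?_⟩
  have hdet : pdet R P (φ : P →ₗ[R] P) =
      LinearMap.det ((φ : P →ₗ[R] P).prodMap (LinearMap.id : Q →ₗ[R] Q)) := by
    let e := β.equivFun
    have hp : (LinearMap.fst R P Q ∘ₗ e.symm.toLinearMap) ∘ₗ (e.toLinearMap ∘ₗ LinearMap.inl R P Q) =
        LinearMap.id := by
      refine LinearMap.ext fun x => ?_
      simp [-Module.Basis.equivFun_symm_apply]
    rw [pdet_eq_detAlong hp, detAlong, ← LinearMap.det_conj _ e]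
    congr 1
    refine LinearMap.ext fun x => ?_
    obtain ⟨y, rfl⟩ := e.surjective x
    have hy : ((φ y.1, y.2) : P × Q) = y + (φ y.1 - y.1, 0) := by ext <;> simp
    simp [-Module.Basis.equivFun_symm_apply, hy]
  rw [hdet, ← e2, ← gramPf_comp_basis (by simp [f.alt, h.alt])]
  exact gramPf_congr fun i j => by simp

theorem AltForm.ofMatrix_single {n : ℕ} (A : Matrix (Fin n) (Fin n) R)
    (hA : IsAlternatingInvertible A) (i j : Fin n) :
    (AltForm.ofMatrix A hA).form (Pi.single i 1) (Pi.single j 1) = A i j := by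
  simp [AltForm.ofMatrix_apply]

theorem isRelPf_ofMatrix (n : ℕ) (A : Matrix (Fin (2 * n)) (Fin (2 * n)) R)
    (hA : IsAlternatingInvertible A) :
    IsRelPf (AltForm.ofMatrix (psi R n) (psi_isAlternatingInvertible n)) (AltForm.ofMatrix A hA)
      (pf n A) := by
  have key : ∀ (A : Matrix (Fin (2 * n)) (Fin (2 * n)) R) (hA : IsAlternatingInvertible A),
      gramPf (perpBilin (AltForm.ofMatrix A hA).form
        (AltForm.ofSubsingleton (M := PUnit.{u + 1})).form) n
        ((Pi.basisFun R (Fin (2 * n))).map (LinearEquiv.prodUnique (M₂ := PUnit.{u + 1})).symm) =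
      pf n A := by
    intro A hA
    rw [gramPf]
    congr 1
    ext i j
    simp [AltForm.ofMatrix_single, AltForm.ofSubsingleton]
  exact ⟨PUnit, _, _, AltForm.ofSubsingleton, n, _, (key _ _).trans (pf_psi n), key A hA⟩

variable [Module.Finite R P] [Module.Projective R P] [Module.Finite R P'] [Module.Projective R P']

/-- A form is an orthogonal summand of a standard form. -/
theorem AltForm.exists_perp_isometric_psi (g : AltForm R P) : ∃ (Q : Type u) (_ : AddCommGroup Q)
    (_ : Module R Q) (_ : Module.Finite R Q) (_ : Module.Projective R Q) (h : AltForm R Q) (n : ℕ),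
    (g.perp h).Isometric (AltForm.ofMatrix (psi R n) (psi_isAlternatingInvertible n)) := by
  obtain ⟨y, m, hy⟩ := (SympClass.mk g).exists_complement
  obtain ⟨Q, _, _, _, _, h, rfl⟩ := y.exists_rep
  rw [← SympClass.mk_perp, ← SympClass.mk_psi] at hy
  exact ⟨Q, _, _, inferInstance, inferInstance, h, m, SympClass.mk_eq_iff.1 hy⟩

theorem exists_isRelPf (g f : AltForm R P) : ∃ r, IsRelPf g f r := by
  obtain ⟨Q, _, _, _, _, h, n, e, he⟩ := g.exists_perp_isometric_psi
  refine ⟨_, Q, _, _, h, n, (Pi.basisFun R (Fin (2 * n))).map e.symm, ?_, rfl⟩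
  rw [← pf_psi (R := R) n, gramPf]
  congr 1
  ext i j
  have := he (e.symm (Pi.single i 1)) (e.symm (Pi.single j 1))
  rw [LinearEquiv.apply_symm_apply, LinearEquiv.apply_symm_apply, AltForm.ofMatrix_single] at this
  simpa using this

/-- The Pfaffian of `f` relative to `g`. -/
def relPf (g f : AltForm R P) : R := (exists_isRelPf g f).choose

theorem isRelPf_relPf (g f : AltForm R P) : IsRelPf g f (relPf g f) :=
  (exists_isRelPf g f).choose_spec

theorem IsRelPf.eq {g f : AltForm R P} {r : R} (h : IsRelPf g f r) : relPf g f = r :=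
  (isRelPf_relPf g f).unique h

theorem relPf_self (g : AltForm R P) : relPf g g = 1 := (isRelPf_relPf g g).self.eq

theorem relPf_mul (g f k : AltForm R P) : relPf g f * relPf f k = relPf g k :=
  ((isRelPf_relPf g f).chain (isRelPf_relPf f k) (isRelPf_relPf g k)).symm

theorem relPf_pullback (g f : AltForm R P) (φ : P ≃ₗ[R] P) :
    relPf g (f.pullback φ) = pdet R P (φ : P →ₗ[R] P) * relPf g f :=
  ((isRelPf_relPf g f).pullback φ).eq

/-- The relative Pfaffian as a unit. -/
def relPfUnit (g f : AltForm R P) : Rˣ where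
  val := relPf g f
  inv := relPf f g
  val_inv := by rw [relPf_mul, relPf_self]
  inv_val := by rw [relPf_mul, relPf_self]

/-- `φ` multiplies the relative Pfaffian, which is a unit, by its determinant. Determinants of
isometries are found in this way, without computing them. -/
theorem mem_SL_of_relPf_eq {g f : AltForm R P} {φ : P ≃ₗ[R] P}
    (h : relPf g (f.pullback φ) = relPf g f) : φ ∈ SL R P := by
  rw [relPf_pullback] at h
  exact (relPfUnit g f).isUnit.mul_eq_right.1 h

theorem Sp_le_SL (f : AltForm R P) : f.Sp ≤ SL R P := fun _ hφ =>
  mem_SL_of_relPf_eq (g := f) (f := f) (congrArg _ (AltForm.ext_form hφ))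

theorem relPf_pullback_of_mem_SL (g f : AltForm R P) {φ : P ≃ₗ[R] P} (hφ : φ ∈ SL R P) :
    relPf g (f.pullback φ) = relPf g f := by
  rw [relPf_pullback, show pdet R P (φ : P →ₗ[R] P) = 1 from hφ, one_mul]

/-- The relative Pfaffian of an isometry class of triples. -/
def relPfClass (x : IsometryClass R) : Additive Rˣ :=
  Quotient.liftOn x (fun T => Additive.ofMul (relPfUnit T.fst T.snd)) (by
    rintro S T ⟨e, h, h'⟩
    exact congrArg Additive.ofMul (Units.ext
      ((isRelPf_relPf S.fst S.snd).of_isometry e h h').eq.symm))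

theorem lift_relPfClass_gen (g f : AltForm R P) :
    FreeAbelianGroup.lift relPfClass (gen g f) = Additive.ofMul (relPfUnit g f) :=
  FreeAbelianGroup.lift_apply_of _ _

variable (R) in
/-- The relative Pfaffian as a homomorphism on `V(R)`. -/
def pfHom : V R →+ Additive Rˣ :=
  QuotientAddGroup.lift _ (FreeAbelianGroup.lift relPfClass)
    (by
      rw [AddSubgroup.closure_le]
      rintro _ (⟨g, f, g', f'⟩ | ⟨f₀, f₁, f₂⟩)
      · simp only [SetLike.mem_coe, AddMonoidHom.mem_ker, map_sub, lift_relPfClass_gen]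
        rw [sub_sub, sub_eq_zero]
        exact congrArg Additive.ofMul (Units.ext
          ((isRelPf_relPf g f).perp (isRelPf_relPf g' f')).eq)
      · simp only [SetLike.mem_coe, AddMonoidHom.mem_ker, map_sub, map_add,
          lift_relPfClass_gen]
        rw [sub_eq_zero]
        exact congrArg Additive.ofMul (Units.ext (relPf_mul f₀ f₁ f₂)))

theorem pfHom_cls (g f : AltForm R P) : pfHom R (V.cls g f) = Additive.ofMul (relPfUnit g f) :=
  lift_relPfClass_gen g f

/-- The generators of `Ṽ(R)` lie in the kernel of the homomorphism that the relative Pfaffian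
induces on `V(R)`, because for `ψ_{2n}` and `A` it is the Pfaffian of `A`. -/
theorem relPf_eq_one_of_mem_Vtilde {g f : AltForm R P} (h : V.cls g f ∈ Vtilde R) :
    relPf g f = 1 := by
  have hle : Vtilde R ≤ (pfHom R).ker := by
    rw [Vtilde, AddSubgroup.closure_le]
    rintro _ ⟨n, A, hA, hpf, rfl⟩
    rw [SetLike.mem_coe, AddMonoidHom.mem_ker, pfHom_cls]
    exact congrArg Additive.ofMul (Units.ext ((isRelPf_ofMatrix n A hA).eq.trans hpf))
  have := hle h
  rw [AddMonoidHom.mem_ker, pfHom_cls] at this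
  exact congrArg Units.val (Additive.ofMul.injective this)

theorem V.cls_self (g : AltForm R P) : V.cls g g = 0 := by
  have h : (QuotientAddGroup.mk (gen g g + gen g g - gen g g) : V R) = 0 :=
    (QuotientAddGroup.eq_zero_iff _).2 (AddSubgroup.subset_closure (VRelator.chain g g g))
  rwa [add_sub_cancel_right] at h

theorem V.cls_perp (g f : AltForm R P) (g' f' : AltForm R P') :
    V.cls (g.perp g') (f.perp f') = V.cls g f + V.cls g' f' := by
  have h : (QuotientAddGroup.mk (gen (g.perp g') (f.perp f') - gen g f - gen g' f') : V R) = 0 :=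
    (QuotientAddGroup.eq_zero_iff _).2 (AddSubgroup.subset_closure (VRelator.sum g f g' f'))
  rw [sub_sub, QuotientAddGroup.mk_sub, QuotientAddGroup.mk_add, sub_eq_zero] at h
  exact h

theorem V.cls_eq_of_isometry {g f : AltForm R P} {g' f' : AltForm R P'} (e : P ≃ₗ[R] P')
    (hg : ∀ x y, g.form x y = g'.form (e x) (e y)) (hf : ∀ x y, f.form x y = f'.form (e x) (e y)) :
    V.cls g f = V.cls g' f' :=
  congrArg (fun x => (QuotientAddGroup.mk (FreeAbelianGroup.of x) : V R))
    (Quotient.sound (s := isometrySetoid R) ⟨e, hg, hf⟩)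

/-- The matrix of a non-degenerate alternating form is alternating and invertible. -/
theorem AltForm.exists_eq_ofMatrix {n : ℕ} (f : AltForm R (Fin n → R)) :
    ∃ (A : Matrix (Fin n) (Fin n) R) (hA : IsAlternatingInvertible A), f = AltForm.ofMatrix A hA := by
  let A := LinearMap.toMatrix₂' R f.form
  have hfA : Matrix.toLinearMap₂' R A = f.form := Matrix.toLinearMap₂'_toMatrix' f.form
  have hA : ∀ i j, A i j = f.form (Pi.single i 1) (Pi.single j 1) := fun i j => by simp [A]
  refine ⟨A, ⟨?_, fun i => by rw [hA, f.alt], ?_⟩, ?_⟩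
  · ext i j
    rw [Matrix.transpose_apply, Matrix.neg_apply, hA, hA, f.skew]
  · choose z hz using fun i => f.bij.2 (LinearMap.proj i)
    have : Matrix.of z * A = 1 := by
      ext i j
      have h := LinearMap.congr_fun (hz i) (Pi.single j 1)
      rw [← hfA, Matrix.toLinearMap₂'_apply', Matrix.dotProduct_mulVec] at h
      simpa [Matrix.one_apply, Pi.single_apply, Matrix.mul_apply, Matrix.vecMul, dotProduct] using h
    exact (Matrix.isUnit_iff_isUnit_det _).1 (IsUnit.of_mul_eq_one_right _ this)
  · exact AltForm.ext_form fun x y => LinearMap.congr_fun₂ hfA.symm x y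

/-- Adding `[Q, k, k] = 0` with `g ⊥ k` isometric to a standard form turns the class into a
generator. Its matrix has Pfaffian `relPf g f`, since `pfHom` sees only the class. -/
theorem mem_Vtilde_of_relPf_eq_one {g f : AltForm R P} (h : relPf g f = 1) :
    V.cls g f ∈ Vtilde R := by
  obtain ⟨Q, _, _, _, _, k, n, e, he⟩ := g.exists_perp_isometric_psi
  obtain ⟨A, hA, hfA⟩ := ((f.perp k).pullback e.symm).exists_eq_ofMatrix
  have h1 : V.cls g f = V.cls (AltForm.ofMatrix (psi R n) (psi_isAlternatingInvertible n))
      (AltForm.ofMatrix A hA) := by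
    rw [← add_zero (V.cls g f), ← V.cls_self k, ← V.cls_perp, ← hfA]
    exact V.cls_eq_of_isometry e he fun x y => by simp
  rw [h1]
  refine AddSubgroup.subset_closure ⟨n, A, hA, ?_, rfl⟩
  have h2 := congrArg (pfHom R) h1
  rw [pfHom_cls, pfHom_cls] at h2
  have h3 := congrArg Units.val (Additive.ofMul.injective h2)
  exact ((isRelPf_ofMatrix n A hA).eq.symm.trans h3.symm).trans h

end RelativePfaffian

/-! ### Forms on `P₀ ⊕ R²` -/

section PdetComm

variable {R : Type u} [CommRing R] {M N : Type*} [AddCommGroup M] [Module R M] [Module.Finite R M]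
  [Module.Projective R M] [AddCommGroup N] [Module R N] [Module.Finite R N] [Module.Projective R N]

/-- Sylvester's identity, transferred from free modules that contain `M` and `N` as summands. -/
theorem pdet_one_add_comp_comm (A : M →ₗ[R] N) (B : N →ₗ[R] M) :
    pdet R N (1 + A ∘ₗ B) = pdet R M (1 + B ∘ₗ A) := by
  obtain ⟨n, p, i, -, -, hp⟩ := Module.Finite.exists_comp_eq_id_of_projective R N
  obtain ⟨m, q, j, -, -, hq⟩ := Module.Finite.exists_comp_eq_id_of_projective R M
  have hp' : ∀ x, p (i x) = x := fun x => LinearMap.congr_fun hp x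
  have hq' : ∀ x, q (j x) = x := fun x => LinearMap.congr_fun hq x
  rw [pdet_eq_detAlong hp, pdet_eq_detAlong hq, detAlong, detAlong]
  have e1 : i ∘ₗ (1 + A ∘ₗ B - 1) ∘ₗ p = (i ∘ₗ A ∘ₗ q) ∘ₗ (j ∘ₗ B ∘ₗ p) :=
    LinearMap.ext fun x => by simp [hq']
  have e2 : j ∘ₗ (1 + B ∘ₗ A - 1) ∘ₗ q = (j ∘ₗ B ∘ₗ p) ∘ₗ (i ∘ₗ A ∘ₗ q) :=
    LinearMap.ext fun x => by simp [hp']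
  rw [e1, e2, det_one_add_comp_comm]

end PdetComm

/-! ### Automorphisms fixing `e₄`, and classification of the forms on `P₀ ⊕ R²`. -/

section Rank

variable {R : Type u} [CommRing R] {P₀ : Type u} [AddCommGroup P₀] [Module R P₀]

variable (R P₀) in
/-- The inclusion of `P₀ ⊕ R` into `P₀ ⊕ R²`. -/
def inclThree : P₀ × R →ₗ[R] P₀ × R × R :=
  (LinearMap.fst R P₀ R).prod ((LinearMap.snd R P₀ R).prod 0)

variable (R P₀) in
/-- The projection of `P₀ ⊕ R²` onto `P₀ ⊕ R`. -/
def projThree : P₀ × R × R →ₗ[R] P₀ × R :=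
  (LinearMap.fst R P₀ (R × R)).prod (LinearMap.fst R R R ∘ₗ LinearMap.snd R P₀ (R × R))

@[simp]
theorem inclThree_apply (x : P₀ × R) : inclThree R P₀ x = (x.1, x.2, 0) := rfl

@[simp]
theorem projThree_apply (x : P₀ × R × R) : projThree R P₀ x = (x.1, x.2.1) := rfl

theorem inclThree_projThree (x : P₀ × R × R) :
    inclThree R P₀ (projThree R P₀ x) = x - x.2.2 • ((0, 0, 1) : P₀ × R × R) := by
  ext <;> simp

/-- The automorphism induced on `P₀ ⊕ R = (P₀ ⊕ R²) / e₄` by an automorphism that fixes `e₄`. -/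
def inducedThree (φ : (P₀ × R × R) ≃ₗ[R] (P₀ × R × R)) (hφ : φ (0, 0, 1) = (0, 0, 1)) :
    (P₀ × R) ≃ₗ[R] (P₀ × R) :=
  have hφ' : φ.symm (0, 0, 1) = (0, 0, 1) := by rw [LinearEquiv.symm_apply_eq, hφ]
  { projThree R P₀ ∘ₗ (φ : (P₀ × R × R) →ₗ[R] (P₀ × R × R)) ∘ₗ inclThree R P₀ with
    invFun := fun x => projThree R P₀ (φ.symm (inclThree R P₀ x))
    left_inv := fun x => by
      change projThree R P₀ (φ.symm (inclThree R P₀ (projThree R P₀ (φ (inclThree R P₀ x))))) = x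
      rw [inclThree_projThree, map_sub, map_smul, hφ', LinearEquiv.symm_apply_apply]
      simp
    right_inv := fun x => by
      change projThree R P₀ (φ (inclThree R P₀ (projThree R P₀ (φ.symm (inclThree R P₀ x))))) = x
      rw [inclThree_projThree, map_sub, map_smul, hφ, LinearEquiv.apply_symm_apply]
      simp }

theorem inducedThree_apply (φ : (P₀ × R × R) ≃ₗ[R] (P₀ × R × R)) (hφ : φ (0, 0, 1) = (0, 0, 1))
    (x : P₀ × R) : inducedThree φ hφ x = projThree R P₀ (φ (inclThree R P₀ x)) := rfl

/-- The automorphism `φ ⊕ 1` of `P₀ ⊕ R²`. -/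
def extendFour (φ : (P₀ × R) ≃ₗ[R] (P₀ × R)) : (P₀ × R × R) ≃ₗ[R] (P₀ × R × R) :=
  (LinearEquiv.prodAssoc R P₀ R R).symm ≪≫ₗ (φ.prodCongr (LinearEquiv.refl R R)) ≪≫ₗ
    LinearEquiv.prodAssoc R P₀ R R

@[simp]
theorem extendFour_apply (φ : (P₀ × R) ≃ₗ[R] (P₀ × R)) (x : P₀ × R × R) :
    extendFour φ x = ((φ (x.1, x.2.1)).1, (φ (x.1, x.2.1)).2, x.2.2) := rfl

theorem extendFour_fix (φ : (P₀ × R) ≃ₗ[R] (P₀ × R)) : extendFour φ (0, 0, 1) = (0, 0, 1) := by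
  have : φ ((0 : P₀), (0 : R)) = 0 := map_zero φ
  simp [this]

theorem inducedThree_extendFour (φ : (P₀ × R) ≃ₗ[R] (P₀ × R)) :
    inducedThree (extendFour φ) (extendFour_fix φ) = φ :=
  LinearEquiv.ext fun x => by rw [inducedThree_apply]; simp

/-- The automorphism `x ↦ x + l(x) e₄` of `P₀ ⊕ R²`, where `l` is a linear form on `P₀ ⊕ R`. -/
def shearFour (l : P₀ × R →ₗ[R] R) : (P₀ × R × R) ≃ₗ[R] (P₀ × R × R) where
  toFun x := (x.1, x.2.1, x.2.2 + l (x.1, x.2.1))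
  map_add' x y := by
    have : l (x.1 + y.1, x.2.1 + y.2.1) = l (x.1, x.2.1) + l (y.1, y.2.1) := by
      rw [← map_add]; rfl
    ext <;> simp [this]; ring
  map_smul' c x := by
    have : l (c • x.1, c * x.2.1) = c * l (x.1, x.2.1) := by
      rw [← smul_eq_mul (b := l _), ← map_smul]; rfl
    ext <;> simp [this]; ring
  invFun x := (x.1, x.2.1, x.2.2 - l (x.1, x.2.1))
  left_inv x := by simp
  right_inv x := by simp

@[simp]
theorem shearFour_apply (l : P₀ × R →ₗ[R] R) (x : P₀ × R × R) :
    shearFour l x = (x.1, x.2.1, x.2.2 + l (x.1, x.2.1)) := rfl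

theorem shearFour_fix (l : P₀ × R →ₗ[R] R) : shearFour l (0, 0, 1) = (0, 0, 1) := by
  have : l ((0 : P₀), (0 : R)) = 0 := map_zero l
  simp [this]

/-- The volume form on `P₀ ⊕ R`. -/
def vol (θ₀ : R ≃ₗ[R] ⋀[R]^2 P₀) (x y z : P₀ × R) : R :=
  x.2 * chi0Bilin θ₀ y.1 z.1 - y.2 * chi0Bilin θ₀ x.1 z.1 + z.2 * chi0Bilin θ₀ x.1 y.1

/-- The radical of the annihilator of `s - t` contains all values of `χ₀`, and these generate the
unit ideal. This takes the place of a localization: inverting `χ₀(x, y)` makes `x`, `y` a basis of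
`P₀`. -/
theorem eq_of_forall_pow_chi0Bilin_mul (θ₀ : R ≃ₗ[R] ⋀[R]^2 P₀) {s t : R}
    (h : ∀ x y, ∃ N : ℕ, chi0Bilin θ₀ x y ^ N * s = chi0Bilin θ₀ x y ^ N * t) : s = t := by
  let I : Ideal R := LinearMap.ker (LinearMap.toSpanSingleton R R (s - t))
  have hle : Ideal.span {r | ∃ x y, chi0Bilin θ₀ x y = r} ≤ I.radical := by
    rw [Ideal.span_le]
    rintro _ ⟨x, y, rfl⟩
    obtain ⟨N, hN⟩ := h x y
    exact ⟨N, by simp [I, mul_sub, hN]⟩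
  rw [chi0Bilin_span] at hle
  obtain ⟨N, hN⟩ := hle (x := 1) trivial
  rw [← sub_eq_zero]
  simpa [I] using hN

/-- The linear form `x ↦ χ(x, e₄)` on `P₀ ⊕ R`. -/
def pairFour (χ : AltForm R (P₀ × R × R)) : P₀ × R →ₗ[R] R :=
  χ.form.flip (0, 0, 1) ∘ₗ inclThree R P₀

theorem pairFour_apply (χ : AltForm R (P₀ × R × R)) (x : P₀ × R) :
    pairFour χ x = χ.form (x.1, x.2, 0) (0, 0, 1) := rfl

/-- The maps between `R⁴` and `P₀ ⊕ R²` given by two elements `x`, `y` of `P₀`. -/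
def frameFour (x y : P₀) : (Fin (2 * 2) → R) →ₗ[R] P₀ × R × R where
  toFun c := (c 0 • x + c 1 • y, c 2, c 3)
  map_add' c d := by
    ext
    · simp; module
    · simp
    · simp
  map_smul' r c := by
    ext
    · simp; module
    · simp
    · simp

@[simp]
theorem frameFour_apply (x y : P₀) (c : Fin (2 * 2) → R) :
    frameFour x y c = (c 0 • x + c 1 • y, c 2, c 3) := rfl

/-- The coordinates with respect to two elements `x`, `y` of `P₀`, up to the factor
`χ₀ (x, y)`. -/
def coframeFour (θ₀ : R ≃ₗ[R] ⋀[R]^2 P₀) (x y : P₀) : P₀ × R × R →ₗ[R] (Fin (2 * 2) → R) where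
  toFun z := ![chi0Bilin θ₀ z.1 y, chi0Bilin θ₀ x z.1, chi0Bilin θ₀ x y * z.2.1,
    chi0Bilin θ₀ x y * z.2.2]
  map_add' z w := by
    ext i
    fin_cases i <;> simp [mul_add]
  map_smul' c z := by
    ext i
    fin_cases i <;> simp [mul_left_comm]

theorem coframeFour_frameFour (θ₀ : R ≃ₗ[R] ⋀[R]^2 P₀) (x y : P₀) (c : Fin (2 * 2) → R) :
    coframeFour θ₀ x y (frameFour x y c) = chi0Bilin θ₀ x y • c := by
  simp only [coframeFour, LinearMap.coe_mk, AddHom.coe_mk, frameFour_apply]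
  ext i
  fin_cases i <;> simp [chi0Bilin_self, mul_comm]

theorem pf_two (A : Matrix (Fin (2 * 2)) (Fin (2 * 2)) R) :
    pf 2 A = A 0 1 * A 2 3 - A 0 2 * A 1 3 + A 0 3 * A 1 2 := by
  simp [pf, Fin.sum_univ_succ, Fin.succAbove]
  ring

variable [Module.Finite R P₀] [Module.Projective R P₀]

/-- As `φ - 1` kills `e₄`, it factors through the projection, so `φ` and the induced map have the
shapes `1 + A B` and `1 + B A` of Sylvester's identity. -/
theorem inducedThree_mem_SL_iff (φ : (P₀ × R × R) ≃ₗ[R] (P₀ × R × R))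
    (hφ : φ (0, 0, 1) = (0, 0, 1)) :
    inducedThree φ hφ ∈ SL R (P₀ × R) ↔ φ ∈ SL R (P₀ × R × R) := by
  have h : pdet R _ (φ : (P₀ × R × R) →ₗ[R] (P₀ × R × R)) =
      pdet R _ (inducedThree φ hφ : (P₀ × R) →ₗ[R] (P₀ × R)) := by
    have e1 : (φ : (P₀ × R × R) →ₗ[R] (P₀ × R × R)) =
        1 + (((φ : (P₀ × R × R) →ₗ[R] (P₀ × R × R)) - 1) ∘ₗ inclThree R P₀) ∘ₗ
          projThree R P₀ := by
      refine LinearMap.ext fun x => ?_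
      simp only [LinearMap.add_apply, LinearMap.comp_apply, inclThree_projThree, map_sub, map_smul]
      simp [hφ]
    have e2 : (inducedThree φ hφ : (P₀ × R) →ₗ[R] (P₀ × R)) =
        1 + projThree R P₀ ∘ₗ
          (((φ : (P₀ × R × R) →ₗ[R] (P₀ × R × R)) - 1) ∘ₗ inclThree R P₀) := by
      refine LinearMap.ext fun x => ?_
      ext <;> simp [inducedThree_apply]
    rw [e2, ← pdet_one_add_comp_comm, ← e1]
  change pdet R _ _ = 1 ↔ pdet R _ _ = 1
  rw [h]

theorem extendFour_mem_SL {φ : (P₀ × R) ≃ₗ[R] (P₀ × R)} (hφ : φ ∈ SL R (P₀ × R)) :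
    extendFour φ ∈ SL R (P₀ × R × R) := by
  rw [← inducedThree_mem_SL_iff _ (extendFour_fix φ), inducedThree_extendFour]
  exact hφ

variable (hrk : ∀ p : PrimeSpectrum R, Module.rankAtStalk P₀ p = 2)
  (θ₀ : R ≃ₗ[R] ⋀[R]^2 P₀)

theorem vasersteinForm_apply (a : (P₀ × R) →ₗ[R] R) (s : P₀ × R) (hs : a s = 1)
    (x y : P₀ × R × R) : (vasersteinForm hrk θ₀ a s hs).form x y =
      vol θ₀ (x.1, x.2.1) (y.1, y.2.1) s + a (x.1, x.2.1) * y.2.2 - a (y.1, y.2.1) * x.2.2 := by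
  have h : (vasersteinForm hrk θ₀ a s hs).form x y =
      chiBilin θ₀ a s (sectionEquiv a s hs (x.1, x.2.1)).1 (sectionEquiv a s hs (y.1, y.2.1)).1 +
        (psiForm R).form (a (x.1, x.2.1), x.2.2) (a (y.1, y.2.1), y.2.2) := rfl
  rw [h, psiForm_apply, chiBilin_apply]
  simp only [sectionEquiv, LinearEquiv.coe_mk, LinearMap.coe_mk, AddHom.coe_mk, vol, Prod.fst_sub,
    Prod.snd_sub, Prod.smul_fst, Prod.smul_snd, map_sub, map_smul, LinearMap.sub_apply,
    LinearMap.smul_apply, smul_eq_mul, chi0Bilin_self, skew_of_alt (chi0Bilin_self θ₀) y.1 s.1]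
  ring

theorem perp_psiForm_apply (x y : P₀ × R × R) : ((chi0 hrk θ₀).perp (psiForm R)).form x y =
    chi0Bilin θ₀ x.1 y.1 + (x.2.1 * y.2.2 - x.2.2 * y.2.1) := by
  rw [AltForm.perp_apply, psiForm_apply]
  rfl

/-- By the Plücker relations the values of `B` and `χ₀` are proportional (`key`). The `r` for which
`r B` is a multiple of `χ₀` form an ideal that contains every value of `χ₀`, hence contains `1`. -/
theorem exists_eq_mul_chi0Bilin (hrk : ∀ p : PrimeSpectrum R, Module.rankAtStalk P₀ p = 2)
    (θ₀ : R ≃ₗ[R] ⋀[R]^2 P₀) {B : P₀ →ₗ[R] P₀ →ₗ[R] R} (hB : ∀ x, B x x = 0) :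
    ∃ c, ∀ x y, B x y = c * chi0Bilin θ₀ x y := by
  have key : ∀ x y z w, B x y * chi0Bilin θ₀ z w = chi0Bilin θ₀ x y * B z w := by
    intro x y z w
    have sB := skew_of_alt hB
    have sC := skew_of_alt (chi0Bilin_self θ₀)
    have h1 := congrArg (fun t => chi0Bilin θ₀ t z) (plucker_of_rank_two hrk hB x y w)
    have h2 := congrArg (fun t => B t w) (plucker_of_rank_two hrk (chi0Bilin_self θ₀) x y z)
    simp only [map_add, map_smul, LinearMap.add_apply, LinearMap.smul_apply, smul_eq_mul, map_zero,
      LinearMap.zero_apply] at h1 h2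
    rw [sC z w, sC z y, sB x w] at h1
    linear_combination -h1 - h2 + B y w * sC x z + B x w * sC y z
  let I : Ideal R := Ideal.span {r | ∃ x y, chi0Bilin θ₀ x y = r}
  have hI : ∀ r ∈ I, ∃ c, ∀ x y, r * B x y = c * chi0Bilin θ₀ x y := by
    intro r hr
    induction hr using Submodule.span_induction with
    | mem r h =>
      obtain ⟨x, y, rfl⟩ := h
      exact ⟨B x y, fun z w => (key x y z w).symm⟩
    | zero => exact ⟨0, fun x y => by simp⟩
    | add r r' _ _ h h' =>
      obtain ⟨c, hc⟩ := h
      obtain ⟨c', hc'⟩ := h'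
      exact ⟨c + c', fun x y => by rw [add_mul, hc, hc', add_mul]⟩
    | smul t r _ h =>
      obtain ⟨c, hc⟩ := h
      exact ⟨t * c, fun x y => by rw [smul_eq_mul, mul_assoc, hc, mul_assoc]⟩
  obtain ⟨c, hc⟩ := hI 1 (by rw [show I = ⊤ from chi0Bilin_span θ₀]; trivial)
  exact ⟨c, fun x y => by rw [← hc, one_mul]⟩

/-- Every form on `P₀ ⊕ R²` is given by a linear form on `P₀ ⊕ R` and an element of `P₀ ⊕ R`. -/
theorem exists_vol_eq (hrk : ∀ p : PrimeSpectrum R, Module.rankAtStalk P₀ p = 2)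
    (θ₀ : R ≃ₗ[R] ⋀[R]^2 P₀) (χ : AltForm R (P₀ × R × R)) : ∃ v : P₀ × R, ∀ x y : P₀ × R × R,
    χ.form x y = vol θ₀ (x.1, x.2.1) (y.1, y.2.1) v + pairFour χ (x.1, x.2.1) * y.2.2 -
      pairFour χ (y.1, y.2.1) * x.2.2 := by
  let j : P₀ →ₗ[R] P₀ × R × R := LinearMap.inl R P₀ (R × R)
  obtain ⟨c, hc⟩ := exists_eq_mul_chi0Bilin hrk θ₀ (B := χ.form.compl₁₂ j j) fun x => χ.alt _
  obtain ⟨w, hw⟩ := (chi0 hrk θ₀).bij.2 (χ.form (0, 1, 0) ∘ₗ j)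
  -- `c` comes from the restriction of `χ` to `P₀`, and `w` represents `χ(e₃, ·)` on `P₀` through
  -- `χ₀`. The sign accounts for `v` being the last argument of `vol`.
  refine ⟨(-w, c), fun x y => ?_⟩
  have e : ∀ z : P₀ × R × R, z = j z.1 + (z.2.1 • (0, 1, 0) + z.2.2 • (0, 0, 1)) := by
    intro z; ext <;> simp [j]
  have hc' : ∀ p q, χ.form (j p) (j q) = c * chi0Bilin θ₀ p q := hc
  have hw' : ∀ p, χ.form (0, 1, 0) (j p) = chi0Bilin θ₀ w p :=
    fun p => (LinearMap.congr_fun hw p).symm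
  have hp : ∀ z : P₀ × R × R, pairFour χ (z.1, z.2.1) = χ.form (j z.1) (0, 0, 1) +
      z.2.1 * χ.form (0, 1, 0) (0, 0, 1) := by
    intro z
    have : ((z.1, z.2.1, 0) : P₀ × R × R) = j z.1 + z.2.1 • (0, 1, 0) := by
      ext <;> simp [j]
    rw [pairFour_apply, this, map_add, map_smul, LinearMap.add_apply, LinearMap.smul_apply,
      smul_eq_mul]
  have sC := skew_of_alt (chi0Bilin_self θ₀)
  rw [hp, hp]
  conv_lhs => rw [e x, e y]
  simp only [map_add, map_smul, LinearMap.add_apply, LinearMap.smul_apply, smul_eq_mul, χ.alt, hc',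
    hw', vol, χ.skew (0, 1, 0) (j x.1), χ.skew (j y.1) (0, 0, 1),
    χ.skew (0, 1, 0) (0, 0, 1), sC w x.1, sC w y.1, map_neg]
  ring

theorem frameFour_coframeFour (hrk : ∀ p : PrimeSpectrum R, Module.rankAtStalk P₀ p = 2)
    (θ₀ : R ≃ₗ[R] ⋀[R]^2 P₀) (x y : P₀) (z : P₀ × R × R) :
    frameFour x y (coframeFour θ₀ x y z) = chi0Bilin θ₀ x y • z := by
  have h := plucker_of_rank_two hrk (chi0Bilin_self θ₀) x y z.1
  rw [skew_of_alt (chi0Bilin_self θ₀) z.1 y, skew_of_alt (chi0Bilin_self θ₀) x z.1] at h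
  rw [frameFour_apply]
  refine Prod.ext ?_ ?_
  · simp [coframeFour]
    linear_combination (norm := module) -h
  · simp [coframeFour]
    rfl

/-- With `u = χ₀(x, y)`, the vectors `x, y, e₃, e₄` form a frame up to the factor `u`, so both forms
can be compared on `R⁴`. There the reference form has Pfaffian `u` and `χ` has Pfaffian `u · a(v)`;
the latter is Cramer's relation between `x, y, e₃, v` evaluated by `a`. -/
theorem relPf_eq_of_vol {χ : AltForm R (P₀ × R × R)} {a : P₀ × R →ₗ[R] R} {v : P₀ × R}
    (hχ : ∀ x y : P₀ × R × R, χ.form x y = vol θ₀ (x.1, x.2.1) (y.1, y.2.1) v +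
      a (x.1, x.2.1) * y.2.2 - a (y.1, y.2.1) * x.2.2) :
    relPf ((chi0 hrk θ₀).perp (psiForm R)) χ = a v := by
  obtain ⟨Q, _, _, h, n, β, e1, e2⟩ := isRelPf_relPf ((chi0 hrk θ₀).perp (psiForm R)) χ
  refine eq_of_forall_pow_chi0Bilin_mul θ₀ fun x y => ?_
  let β' : Module.Basis (Fin (2 * 2)) R ((Fin (2 * 2) → R) × PUnit.{u + 1}) :=
    (Pi.basisFun R (Fin (2 * 2))).map (LinearEquiv.prodUnique (M₂ := PUnit.{u + 1})).symm
  have hβ' : ∀ B : (Fin (2 * 2) → R) →ₗ[R] (Fin (2 * 2) → R) →ₗ[R] R,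
      gramPf (perpBilin B (0 : PUnit.{u + 1} →ₗ[R] PUnit.{u + 1} →ₗ[R] R)) 2 β' =
        gramPf B 2 (fun i => Pi.single i 1) :=
    fun B => gramPf_congr fun i j => by simp [β']
  obtain ⟨N, hN⟩ := exists_pow_mul_gramPf_eq β β' (frameFour x y) (coframeFour θ₀ x y)
    (chi0Bilin θ₀ x y) (frameFour_coframeFour hrk θ₀ x y) (coframeFour_frameFour θ₀ x y)
    (f := χ.form) (g := ((chi0 hrk θ₀).perp (psiForm R)).form) (h := h.form)
    (k := (AltForm.ofMatrix (psi R 2) (psi_isAlternatingInvertible 2)).form)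
    (h' := (0 : PUnit.{u + 1} →ₗ[R] PUnit.{u + 1} →ₗ[R] R)) χ.alt (AltForm.alt _) h.alt (AltForm.alt _)
    (fun _ => rfl) (by
      rw [hβ', gramPf]
      refine (congrArg (pf 2) ?_).trans (pf_psi (R := R) 2)
      ext i j
      exact AltForm.ofMatrix_single (psi R 2) (psi_isAlternatingInvertible 2) i j)
  have f1 : gramPf (((chi0 hrk θ₀).perp (psiForm R)).form.compl₁₂ (frameFour x y) (frameFour x y)) 2
      (fun i => Pi.single i 1) = chi0Bilin θ₀ x y := by
    rw [gramPf, pf_two]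
    simp only [Matrix.of_apply, LinearMap.compl₁₂_apply, perp_psiForm_apply, frameFour_apply]
    simp
  have f2 : gramPf (χ.form.compl₁₂ (frameFour x y) (frameFour x y)) 2
      (fun i => Pi.single i 1) = chi0Bilin θ₀ x y * a v := by
    have hc := congrArg a (cramer_four hrk θ₀ (x, 0) (y, 0) (0, 1) v (vol θ₀) fun _ _ _ => rfl)
    have hxy : vol θ₀ (x, 0) (y, 0) (0, 1) = chi0Bilin θ₀ x y := by simp [vol]
    simp only [map_add, map_sub, map_smul, smul_eq_mul, map_zero, hxy] at hc
    rw [gramPf, pf_two]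
    simp only [Matrix.of_apply, LinearMap.compl₁₂_apply, hχ, frameFour_apply]
    have h0 : ∀ x, vol θ₀ x ((0 : P₀), (0 : R)) v = 0 := fun x => by simp [vol]
    simp [h0]
    linear_combination hc
  rw [e1, e2, hβ', hβ', f1, f2] at hN
  -- The extra power is the factor `χ₀(x, y)` common to the two frame Pfaffians.
  refine ⟨N + 1, ?_⟩
  linear_combination hN

theorem relPf_vasersteinForm (a : (P₀ × R) →ₗ[R] R) (s : P₀ × R) (hs : a s = 1) :
    relPf ((chi0 hrk θ₀).perp (psiForm R)) (vasersteinForm hrk θ₀ a s hs) = 1 := by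
  rw [relPf_eq_of_vol hrk θ₀ (vasersteinForm_apply hrk θ₀ a s hs), hs]

/-- The forms of relative Pfaffian `1` on `P₀ ⊕ R²` are the forms `V(a, s)`. -/
theorem exists_eq_vasersteinForm {χ : AltForm R (P₀ × R × R)}
    (hχ : relPf ((chi0 hrk θ₀).perp (psiForm R)) χ = 1) :
    ∃ (s : P₀ × R) (hs : pairFour χ s = 1), χ = vasersteinForm hrk θ₀ (pairFour χ) s hs := by
  obtain ⟨v, hv⟩ := exists_vol_eq hrk θ₀ χ
  rw [relPf_eq_of_vol hrk θ₀ hv] at hχ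
  exact ⟨v, hχ, AltForm.ext_form fun x y => by rw [vasersteinForm_apply, hv]⟩

theorem pairFour_vasersteinForm (a : (P₀ × R) →ₗ[R] R) (s : P₀ × R) (hs : a s = 1) :
    pairFour (vasersteinForm hrk θ₀ a s hs) = a := by
  refine LinearMap.ext fun x => ?_
  rw [pairFour_apply, vasersteinForm_apply]
  have : a ((0 : P₀), (0 : R)) = 0 := map_zero a
  simp [vol, this]

/-- The forms `V(a, s)` for different sections `s` are isometric by an automorphism that fixes
`e₄`. -/
theorem exists_vasersteinForm_eq_pullback (a : (P₀ × R) →ₗ[R] R) (s s' : P₀ × R) (hs : a s = 1)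
    (hs' : a s' = 1) : ∃ φ : (P₀ × R × R) ≃ₗ[R] (P₀ × R × R), φ (0, 0, 1) = (0, 0, 1) ∧
      vasersteinForm hrk θ₀ a s' hs' = (vasersteinForm hrk θ₀ a s hs).pullback φ := by
  let l : P₀ × R →ₗ[R] R :=
    { toFun := fun x => -vol θ₀ x s s'
      map_add' := fun x y => by simp [vol]; ring
      map_smul' := fun c x => by simp [vol]; ring }
  have hl : ∀ x, l x = -vol θ₀ x s s' := fun _ => rfl
  -- The shear adds `a(x) l(y) - a(y) l(x)` to the form. Cramer's relation between `x, y, s, s'`,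
  -- evaluated by `a`, identifies this with `vol(x, y, s') - vol(x, y, s)`.
  refine ⟨shearFour l, shearFour_fix l, AltForm.ext_form fun x y => ?_⟩
  have hc := congrArg a (cramer_four hrk θ₀ (x.1, x.2.1) (y.1, y.2.1) s s' (vol θ₀)
    fun _ _ _ => rfl)
  simp only [map_add, map_sub, map_smul, smul_eq_mul, map_zero, hs, hs', mul_one] at hc
  rw [AltForm.pullback_apply, vasersteinForm_apply, vasersteinForm_apply]
  simp only [shearFour_apply, hl]
  linear_combination hc

/-- The form `V(a, s)` pulled back along an automorphism of determinant one that fixes `e₄`. -/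
theorem exists_pullback_vasersteinForm_eq (a : (P₀ × R) →ₗ[R] R) (s : P₀ × R) (hs : a s = 1)
    {φ : (P₀ × R) ≃ₗ[R] (P₀ × R)} (hφ : φ ∈ SL R (P₀ × R)) :
    ∃ (t : P₀ × R) (ht : (a ∘ₗ (φ : (P₀ × R) →ₗ[R] (P₀ × R))) t = 1),
      (vasersteinForm hrk θ₀ a s hs).pullback (extendFour φ) =
        vasersteinForm hrk θ₀ (a ∘ₗ (φ : (P₀ × R) →ₗ[R] (P₀ × R))) t ht := by
  have h : pairFour ((vasersteinForm hrk θ₀ a s hs).pullback (extendFour φ)) =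
      a ∘ₗ (φ : (P₀ × R) →ₗ[R] (P₀ × R)) := by
    refine LinearMap.ext fun x => ?_
    conv_rhs => rw [← pairFour_vasersteinForm hrk θ₀ a s hs]
    rw [pairFour_apply, AltForm.pullback_apply, extendFour_fix]
    rfl
  -- No formula for `t` is needed: the pullback still has relative Pfaffian `1`, so it is some `V(·,
  -- t)`, and its linear form was computed in `h`.
  obtain ⟨t, ht, e⟩ := exists_eq_vasersteinForm hrk θ₀
    ((relPf_pullback_of_mem_SL ((chi0 hrk θ₀).perp (psiForm R)) _ (extendFour_mem_SL hφ)).trans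
      (relPf_vasersteinForm hrk θ₀ a s hs))
  exact ⟨t, h ▸ ht, AltForm.ext_form fun x y => by
    refine (congrArg (fun χ => χ.form x y) e).trans ?_
    rw [vasersteinForm_apply, vasersteinForm_apply, h]⟩

end Rank

/-! ### Stable range -/

section Avoidance

variable {R : Type*} [CommRing R] {N : Type*} [AddCommGroup N] [Module R N]

/-- Prime avoidance for conditions on the elements of a module, each of which depends only on the
residue class modulo a prime and can be satisfied by a change in every residue class. -/
theorem exists_forall_not_bad (S : Finset (Ideal R)) (hS : ∀ Q ∈ S, Q.IsPrime)
    (Bad : Ideal R → N → Prop)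
    (h₁ : ∀ Q ∈ S, ∀ x, ¬ Bad Q x → ∀ s ∈ Q, ∀ n, ¬ Bad Q (x + s • n))
    (h₂ : ∀ Q ∈ S, ∀ x, ∀ s ∉ Q, ∃ n, ¬ Bad Q (x + s • n)) : ∃ x, ∀ Q ∈ S, ¬ Bad Q x := by
  classical
  induction S using Finset.strongInduction with
  | H S ih =>
    rcases S.eq_empty_or_nonempty with rfl | hne
    · exact ⟨0, by simp⟩
    -- A minimal prime is treated last: it contains no other prime of `S`, so some `s` outside it
    -- lies in all the others, and multiples of `s` leave the conditions there intact.
    obtain ⟨P, hP⟩ := S.exists_minimal hne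
    obtain ⟨x, hx⟩ := ih (S.erase P) (Finset.erase_ssubset hP.1)
      (fun Q hQ => hS Q (Finset.mem_of_mem_erase hQ))
      (fun Q hQ => h₁ Q (Finset.mem_of_mem_erase hQ))
      (fun Q hQ => h₂ Q (Finset.mem_of_mem_erase hQ))
    have hle : ¬ (S.erase P).inf id ≤ P := by
      rw [(hS P hP.1).inf_le']
      rintro ⟨Q, hQ, hQP⟩
      rw [Finset.mem_erase] at hQ
      exact hQ.1 (le_antisymm hQP (hP.2 hQ.2 hQP))
    obtain ⟨s, hs, hsP⟩ := SetLike.not_le_iff_exists.1 hle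
    obtain ⟨n, hn⟩ := h₂ P hP.1 x s hsP
    refine ⟨x + s • n, fun Q hQ => ?_⟩
    by_cases hQP : Q = P
    · rwa [hQP]
    · have hQ' : Q ∈ S.erase P := Finset.mem_erase.2 ⟨hQP, hQ⟩
      exact h₁ Q hQ x (hx Q hQ') s (Finset.inf_le (f := id) hQ' hs) n

end Avoidance

/-! ### Heights off the locus `y = 0`, and the stable range condition. -/

section StableRange

variable {R : Type u} [CommRing R]

/-- Every prime that contains `I` and does not contain `y` has height at least `k`. -/
def HeightOff (y : R) (I : Ideal R) (k : ℕ) : Prop :=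
  ∀ Q : Ideal R, Q.IsPrime → I ≤ Q → y ∉ Q → (k : ℕ∞) ≤ Q.height

/-- A minimal prime over `I` inside `Q` also avoids `y`, so it has height at least `k`. If it were
strictly smaller than `Q`, then `Q` would have height at least `k + 1`. -/
theorem HeightOff.mem_minimalPrimes {y : R} {I : Ideal R} {k : ℕ} (h : HeightOff y I k)
    {Q : Ideal R} (hQ : Q.IsPrime) (hI : I ≤ Q) (hy : y ∉ Q) (hk : ¬ ((k + 1 : ℕ) : ℕ∞) ≤ Q.height) :
    Q ∈ I.minimalPrimes := by
  obtain ⟨Q', hQ', hle⟩ := Ideal.exists_minimalPrimes_le hI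
  rcases hle.eq_or_lt with rfl | hlt
  · exact hQ'
  · have := hQ'.1.1
    have h1 := h Q' this hQ'.1.2 fun hy' => hy (hle hy')
    have h2 := Ideal.height_add_one_le_of_lt_of_isPrime hlt
    refine absurd (le_trans ?_ h2) hk
    push_cast
    gcongr

variable (R) in
/-- Unimodular elements of `N ⊕ R²` can be shortened to unimodular elements of `N ⊕ R` by adding
multiples of the last coordinate. -/
def HasStableRange (N : Type*) [AddCommGroup N] [Module R N] : Prop :=
  ∀ (n : N) (x y : R), (∃ (l : N →ₗ[R] R) (α β : R), l n + α * x + β * y = 1) →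
    ∃ (m : N) (r : R) (l : N →ₗ[R] R) (α : R), l (n + y • m) + α * (x + y * r) = 1

variable [IsNoetherianRing R]

/-- Since `y` is invertible at the finitely many minimal primes over `I` that avoid it, `t` can be
chosen with `a + y t` outside all of them. A prime over the larger ideal that avoids `y` is then not
minimal over `I`. -/
theorem HeightOff.exists_sup_span {y : R} {I : Ideal R} {k : ℕ} (h : HeightOff y I k) (a : R) :
    ∃ t, HeightOff y (I ⊔ Ideal.span {a + y * t}) (k + 1) := by
  classical
  have hfin : {Q | Q ∈ I.minimalPrimes ∧ y ∉ Q}.Finite :=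
    (Ideal.finite_minimalPrimes_of_isNoetherianRing R I).subset fun Q hQ => hQ.1
  obtain ⟨t, ht⟩ := exists_forall_not_bad (N := R) hfin.toFinset
    (fun Q hQ => (hfin.mem_toFinset.1 hQ).1.1.1) (fun Q t => a + y * t ∈ Q)
    (by
      intro Q hQ x hx s hs n hn
      refine hx ?_
      have : a + y * x = a + y * (x + s • n) - (y * n) * s := by simp; ring
      rw [this]
      exact Q.sub_mem hn (Q.mul_mem_left _ hs))
    (by
      intro Q hQ x s hs
      have hQ' := hfin.mem_toFinset.1 hQ
      have hp := hQ'.1.1.1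
      by_cases hx : a + y * x ∈ Q
      · refine ⟨1, fun h1 => ?_⟩
        have : y * s ∈ Q := by
          have h2 := Q.sub_mem h1 hx
          have e : a + y * (x + s • 1) - (a + y * x) = y * s := by simp; ring
          rwa [e] at h2
        exact (hp.mem_or_mem this).elim hQ'.2 hs
      · exact ⟨0, by simpa using hx⟩)
  refine ⟨t, fun Q hQ hI hy => ?_⟩
  by_contra hk
  have hmin := h.mem_minimalPrimes hQ (le_sup_left.trans hI) hy hk
  refine ht Q (hfin.mem_toFinset.2 ⟨hmin, hy⟩) (hI ?_)
  exact Ideal.mem_sup_right (Ideal.mem_span_singleton_self _)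

variable {P₀ : Type u} [AddCommGroup P₀] [Module R P₀]

/-- An alternating form gives for each element the ideal of its values at this element. -/
theorem exists_heightOff_two (B : P₀ →ₗ[R] P₀ →ₗ[R] R) (hB : ∀ x, B x x = 0)
    (hspan : Ideal.span {r | ∃ x y, B x y = r} = ⊤) (y : R) (p : P₀) :
    ∃ q, HeightOff y (LinearMap.range (B (p + y • q))) 2 := by
  classical
  let O : P₀ → Ideal R := fun v => LinearMap.range (B v)
  have hO : ∀ v (Q : Ideal R), O v ≤ Q ↔ ∀ q, B v q ∈ Q := by
    intro v Q
    constructor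
    · exact fun h q => h ⟨q, rfl⟩
    · rintro h _ ⟨q, rfl⟩
      exact h q
  have hproper : ∀ Q : Ideal R, Q.IsPrime → ∃ n, ¬ O n ≤ Q := by
    intro Q hQ
    by_contra hall
    push Not at hall
    refine hQ.ne_top (top_le_iff.1 ?_)
    rw [← hspan, Ideal.span_le]
    rintro _ ⟨x, z, rfl⟩
    exact (hO x Q).1 (hall x) z
  have hadd : ∀ v w (Q : Ideal R), O v ≤ Q → O (v + w) ≤ Q → O w ≤ Q := by
    intro v w Q h1 h2
    rw [hO] at *
    intro q
    have := Q.sub_mem (h2 q) (h1 q)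
    simpa using this
  have hadd' : ∀ v w (Q : Ideal R), O w ≤ Q → O (v + w) ≤ Q → O v ≤ Q := fun v w Q h1 h2 =>
    hadd w v Q h1 (add_comm v w ▸ h2)
  have hsmul : ∀ v s (Q : Ideal R), s ∈ Q → O (s • v) ≤ Q := by
    intro v s Q hs
    rw [hO]
    intro q
    simpa using Q.mul_mem_right _ hs
  have hsmul' : ∀ v s (Q : Ideal R), Q.IsPrime → s ∉ Q → O (s • v) ≤ Q → O v ≤ Q := by
    intro v s Q hQ hs h
    rw [hO] at *
    intro q
    have := h q
    rw [map_smul, LinearMap.smul_apply, smul_eq_mul] at this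
    exact (hQ.mem_or_mem this).resolve_left hs
  -- the values at `v` generate an ideal of positive height
  have hfin₀ : {Q | Q ∈ minimalPrimes R ∧ y ∉ Q}.Finite :=
    (Ideal.finite_minimalPrimes_of_isNoetherianRing R ⊥).subset fun Q hQ => hQ.1
  obtain ⟨q₁, hq₁⟩ := exists_forall_not_bad (N := P₀) hfin₀.toFinset
    (fun Q hQ => (hfin₀.mem_toFinset.1 hQ).1.1.1) (fun Q q => O (p + y • q) ≤ Q)
    (by
      intro Q hQ x hx s hs n hn
      rw [smul_add, ← add_assoc, smul_comm] at hn
      exact hx (hadd' _ _ Q (hsmul _ s Q hs) hn))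
    (by
      intro Q hQ x s hs
      have hQ' := hfin₀.mem_toFinset.1 hQ
      by_cases hx : O (p + y • x) ≤ Q
      · obtain ⟨n, hn⟩ := hproper Q hQ'.1.1.1
        refine ⟨n, fun h1 => hn ?_⟩
        rw [smul_add, ← add_assoc] at h1
        exact hsmul' _ s Q hQ'.1.1.1 hs (hsmul' _ y Q hQ'.1.1.1 hQ'.2 (hadd _ _ Q hx h1))
      · exact ⟨0, by simpa using hx⟩)
  set v := p + y • q₁ with hv
  have hv₀ : ∀ Q ∈ minimalPrimes R, y ∉ Q → ¬ O v ≤ Q := fun Q hQ hy =>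
    hq₁ Q (hfin₀.mem_toFinset.2 ⟨hQ, hy⟩)
  have hOv : HeightOff y (O v) 1 := by
    intro Q hQ hle hy
    rw [Nat.cast_one, Order.one_le_iff_pos, pos_iff_ne_zero, ne_eq, Ideal.height_eq_zero_iff]
    exact fun h => hv₀ Q h hy hle
  -- a second element that is independent of `v` in height zero, and nonzero where `v` vanishes
  have hfin₁ : {Q | (Q ∈ minimalPrimes R ∨ Q ∈ (O v).minimalPrimes) ∧ y ∉ Q}.Finite :=
    ((Ideal.finite_minimalPrimes_of_isNoetherianRing R ⊥).union
      (Ideal.finite_minimalPrimes_of_isNoetherianRing R (O v))).subset fun Q hQ => hQ.1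
  have hprime₁ : ∀ Q ∈ hfin₁.toFinset, Q.IsPrime := by
    intro Q hQ
    rcases (hfin₁.mem_toFinset.1 hQ).1 with h | h <;> exact h.1.1
  obtain ⟨w, hw⟩ := exists_forall_not_bad (N := P₀) hfin₁.toFinset hprime₁
    (fun Q x => if O v ≤ Q then O x ≤ Q else B v x ∈ Q)
    (by
      intro Q hQ x hx s hs n hn
      split_ifs at hx hn with h
      · exact hx (hadd' _ _ Q (hsmul _ s Q hs) hn)
      · rw [map_add, map_smul, smul_eq_mul] at hn
        exact hx ((Q.add_mem_iff_left (Q.mul_mem_right _ hs)).1 hn))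
    (by
      intro Q hQ x s hs
      have hp := hprime₁ Q hQ
      split_ifs with h
      · by_cases hx : O x ≤ Q
        · obtain ⟨n, hn⟩ := hproper Q hp
          exact ⟨n, fun h1 => hn (hsmul' _ s Q hp hs (hadd _ _ Q hx h1))⟩
        · exact ⟨0, by simpa using hx⟩
      · by_cases hx : B v x ∈ Q
        · rw [hO] at h
          push Not at h
          obtain ⟨n, hn⟩ := h
          refine ⟨n, fun h1 => ?_⟩
          rw [map_add, map_smul, smul_eq_mul] at h1
          exact (hp.mem_or_mem ((Q.add_mem_iff_right hx).1 h1)).elim hs hn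
        · exact ⟨0, by simpa using hx⟩)
  have hw₀ : ∀ Q ∈ minimalPrimes R, y ∉ Q → B v w ∉ Q := by
    intro Q hQ hy
    have := hw Q (hfin₁.mem_toFinset.2 ⟨Or.inl hQ, hy⟩)
    rwa [if_neg (hv₀ Q hQ hy)] at this
  have hw₁ : ∀ Q ∈ (O v).minimalPrimes, y ∉ Q → ¬ O w ≤ Q := by
    intro Q hQ hy
    have := hw Q (hfin₁.mem_toFinset.2 ⟨Or.inr hQ, hy⟩)
    rwa [if_pos hQ.1.2] at this
  -- a combination that does not vanish in height one
  let I : Ideal R := Ideal.span {B v w}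
  have hI : HeightOff y I 1 := by
    intro Q hQ hle hy
    rw [Nat.cast_one, Order.one_le_iff_pos, pos_iff_ne_zero, ne_eq, Ideal.height_eq_zero_iff]
    exact fun h => hw₀ Q h hy (hle (Ideal.mem_span_singleton_self _))
  -- For every `c`, the value of `B` at `v + c y w` and `w` is `B v w`, because `B w w = 0`. So the
  -- primes of height below `2` to be avoided are minimal over `I`, and there are finitely many of
  -- them, independently of `c`.
  have hfin₂ : {Q | Q ∈ I.minimalPrimes ∧ y ∉ Q ∧ ¬ ((1 + 1 : ℕ) : ℕ∞) ≤ Q.height}.Finite :=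
    (Ideal.finite_minimalPrimes_of_isNoetherianRing R I).subset fun Q hQ => hQ.1
  obtain ⟨c, hc⟩ := exists_forall_not_bad (N := R) hfin₂.toFinset
    (fun Q hQ => (hfin₂.mem_toFinset.1 hQ).1.1.1) (fun Q c => O (v + c • y • w) ≤ Q)
    (by
      intro Q hQ x hx s hs n hn
      rw [add_smul, ← add_assoc, smul_eq_mul, mul_smul] at hn
      exact hx (hadd' _ _ Q (hsmul _ s Q hs) hn))
    (by
      intro Q hQ x s hs
      obtain ⟨hmin, hy, hht⟩ := hfin₂.mem_toFinset.1 hQ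
      have hp := hmin.1.1
      by_cases hx : O (v + x • y • w) ≤ Q
      · refine ⟨1, fun h1 => ?_⟩
        rw [add_smul, ← add_assoc, smul_eq_mul, mul_one] at h1
        have hOw : O w ≤ Q := hsmul' _ y Q hp hy (hsmul' _ s Q hp hs (hadd _ _ Q hx h1))
        have hOv' : O v ≤ Q := by
          refine hadd' v (x • y • w) Q ?_ hx
          rw [hO] at hOw ⊢
          intro q
          simpa using Q.mul_mem_left x (Q.mul_mem_left y (hOw q))
        -- `Q` contains all values at `v` and has height below `2`, so it is minimal over their
        -- ideal. The element `w` was chosen not to vanish at such primes.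
        exact hw₁ Q (hOv.mem_minimalPrimes hp hOv' hy hht) hy hOw
      · exact ⟨0, by simpa using hx⟩)
  refine ⟨q₁ + c • w, fun Q hQ hle hy => ?_⟩
  have e : p + y • (q₁ + c • w) = v + c • y • w := by
    rw [hv]
    module
  rw [e] at hle
  by_contra hht
  have hIQ : I ≤ Q := by
    rw [Ideal.span_singleton_le_iff_mem]
    have := hle ⟨w, rfl⟩
    simpa [hB] using this
  exact hc Q (hfin₂.mem_toFinset.2 ⟨hI.mem_minimalPrimes hQ hIQ hy hht, hy, hht⟩) hle

/-- The component in `P₀` yields height `2` off `y`, and each of `a₁`, `a₂`, `x` adds one. The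
resulting `5` exceeds the dimension, so a prime containing the order ideal `J` of the shortened
vector contains `y`. Modulo `y` the vector has not changed, so it is still unimodular there, and no
such prime exists. -/
theorem hasStableRange_of_ringKrullDim_le (hdim : ringKrullDim R ≤ 4) [Module.Finite R P₀]
    [Module.Projective R P₀] (θ₀ : R ≃ₗ[R] ⋀[R]^2 P₀) (N : Type*) [AddCommGroup N] [Module R N] :
    HasStableRange R ((P₀ × R × R) × N) := by
  rintro ⟨⟨p, a₁, a₂⟩, n⟩ x y ⟨l, α, β, hl⟩
  obtain ⟨q, hq⟩ := exists_heightOff_two (chi0Bilin θ₀) (chi0Bilin_self θ₀) (chi0Bilin_span θ₀) y p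
  obtain ⟨t₁, h₁⟩ := hq.exists_sup_span a₁
  obtain ⟨t₂, h₂⟩ := h₁.exists_sup_span a₂
  obtain ⟨r, h₃⟩ := h₂.exists_sup_span x
  let m : (P₀ × R × R) × N := ((q, t₁, t₂), 0)
  let z : (P₀ × R × R) × N := ((p, a₁, a₂), n)
  refine ⟨m, r, ?_⟩
  let J : Ideal R := LinearMap.range
    ((Module.Dual.eval R ((P₀ × R × R) × N) (z + y • m)).coprod
      (LinearMap.toSpanSingleton R R (x + y * r)))
  have hJ : ∀ (l : ((P₀ × R × R) × N) →ₗ[R] R) (α : R), l (z + y • m) + α * (x + y * r) ∈ J :=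
    fun l α => ⟨(l, α), by simp⟩
  have htop : J = ⊤ := by
    by_contra hne
    obtain ⟨Q, hQ, hJQ⟩ := Ideal.exists_le_maximal J hne
    have hQp := hQ.isPrime
    by_cases hy : y ∈ Q
    · refine hQ.ne_top ((Ideal.eq_top_iff_one Q).2 ?_)
      have h1 := hJQ (hJ l α)
      have e : (1 : R) = l (z + y • m) + α * (x + y * r) + y * (β - l m - α * r) := by
        rw [← hl, map_add, map_smul, smul_eq_mul]
        ring
      rw [e]
      exact Q.add_mem h1 (Q.mul_mem_right _ hy)
    · have hle := h₃ Q hQp (le_trans ?_ hJQ) hy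
      · have h5 := Ideal.height_le_ringKrullDim_of_isPrime (I := Q)
        have h6 : ((5 : ℕ∞) : WithBot ℕ∞) ≤ 4 :=
          (WithBot.coe_le_coe.2 hle).trans (h5.trans hdim)
        exact absurd h6 (by decide)
      · refine sup_le (sup_le (sup_le ?_ ?_) ?_) ?_
        · rintro _ ⟨p', rfl⟩
          have := hJ ((chi0Bilin θ₀).flip p' ∘ₗ LinearMap.fst R P₀ (R × R) ∘ₗ
            LinearMap.fst R (P₀ × R × R) N) 0
          simpa [z, m] using this
        · rw [Ideal.span_singleton_le_iff_mem]
          have := hJ (LinearMap.fst R R R ∘ₗ LinearMap.snd R P₀ (R × R) ∘ₗ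
            LinearMap.fst R (P₀ × R × R) N) 0
          simpa [z, m] using this
        · rw [Ideal.span_singleton_le_iff_mem]
          have := hJ (LinearMap.snd R R R ∘ₗ LinearMap.snd R P₀ (R × R) ∘ₗ
            LinearMap.fst R (P₀ × R × R) N) 0
          simpa [z, m] using this
        · rw [Ideal.span_singleton_le_iff_mem]
          have := hJ 0 1
          simpa [z, m] using this
  have h1 : (1 : R) ∈ J := by rw [htop]; trivial
  obtain ⟨⟨l', α'⟩, h'⟩ := h1
  exact ⟨l', α', by simpa using h'⟩

end StableRange

/-! ### Cancellation of hyperbolic planes -/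

section Cancellation

variable {R : Type u} [CommRing R] {N N' : Type*} [AddCommGroup N] [Module R N]
  [AddCommGroup N'] [Module R N']

namespace AltForm

/-- The symplectic transvection of `N ⊕ R²` along the first vector of the hyperbolic plane. -/
def transvFst (F : AltForm R N) (m : N) : (N × R × R) ≃ₗ[R] (N × R × R) where
  toFun z := (z.1 + z.2.2 • m, z.2.1 + F.form m z.1, z.2.2)
  map_add' z w := by
    ext
    · simp; module
    · simp; ring
    · simp
  map_smul' c z := by
    ext
    · simp; module
    · simp; ring
    · simp
  invFun z := (z.1 - z.2.2 • m, z.2.1 - F.form m z.1, z.2.2)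
  left_inv z := by simp [F.alt]
  right_inv z := by simp [F.alt]

/-- The symplectic transvection of `N ⊕ R²` along the second vector of the hyperbolic plane. -/
def transvSnd (F : AltForm R N) (m : N) : (N × R × R) ≃ₗ[R] (N × R × R) where
  toFun z := (z.1 + z.2.1 • m, z.2.1, z.2.2 - F.form m z.1)
  map_add' z w := by
    ext
    · simp; module
    · simp
    · simp; ring
  map_smul' c z := by
    ext
    · simp; module
    · simp
    · simp; ring
  invFun z := (z.1 - z.2.1 • m, z.2.1, z.2.2 + F.form m z.1)
  left_inv z := by simp [F.alt]
  right_inv z := by simp [F.alt]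

theorem perp_psiForm_form (F : AltForm R N) (z w : N × R × R) : (F.perp (psiForm R)).form z w =
    F.form z.1 w.1 + (z.2.1 * w.2.2 - z.2.2 * w.2.1) := by
  rw [perp_apply, psiForm_apply]

theorem transvFst_mem_Sp (F : AltForm R N) (m : N) : F.transvFst m ∈ (F.perp (psiForm R)).Sp := by
  intro z w
  simp only [perp_psiForm_form, transvFst, LinearEquiv.coe_mk, LinearMap.coe_mk, AddHom.coe_mk,
    map_add, map_smul, LinearMap.add_apply, LinearMap.smul_apply, smul_eq_mul, F.alt, F.skew m z.1]
  ring

theorem transvSnd_mem_Sp (F : AltForm R N) (m : N) : F.transvSnd m ∈ (F.perp (psiForm R)).Sp := by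
  intro z w
  simp only [perp_psiForm_form, transvSnd, LinearEquiv.coe_mk, LinearMap.coe_mk, AddHom.coe_mk,
    map_add, map_smul, LinearMap.add_apply, LinearMap.smul_apply, smul_eq_mul, F.alt, F.skew m z.1]
  ring

/-- The elementary transformation of the hyperbolic plane that adds a multiple of the second
coordinate to the first. -/
def elemFst (R : Type u) [CommRing R] (N : Type*) [AddCommGroup N] [Module R N] (r : R) :
    (N × R × R) ≃ₗ[R] (N × R × R) where
  toFun z := (z.1, z.2.1 + r * z.2.2, z.2.2)
  map_add' z w := by ext <;> simp; ring
  map_smul' c z := by ext <;> simp; ring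
  invFun z := (z.1, z.2.1 - r * z.2.2, z.2.2)
  left_inv z := by simp
  right_inv z := by simp

/-- The elementary transformation of the hyperbolic plane that adds a multiple of the first
coordinate to the second. -/
def elemSnd (R : Type u) [CommRing R] (N : Type*) [AddCommGroup N] [Module R N] (r : R) :
    (N × R × R) ≃ₗ[R] (N × R × R) where
  toFun z := (z.1, z.2.1, z.2.2 + r * z.2.1)
  map_add' z w := by ext <;> simp; ring
  map_smul' c z := by ext <;> simp; ring
  invFun z := (z.1, z.2.1, z.2.2 - r * z.2.1)
  left_inv z := by simp
  right_inv z := by simp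

theorem elemFst_mem_Sp (F : AltForm R N) (r : R) : elemFst R N r ∈ (F.perp (psiForm R)).Sp := by
  intro z w
  simp only [perp_psiForm_form, elemFst, LinearEquiv.coe_mk, LinearMap.coe_mk, AddHom.coe_mk]
  ring

theorem elemSnd_mem_Sp (F : AltForm R N) (r : R) : elemSnd R N r ∈ (F.perp (psiForm R)).Sp := by
  intro z w
  simp only [perp_psiForm_form, elemSnd, LinearEquiv.coe_mk, LinearMap.coe_mk, AddHom.coe_mk]
  ring

/-- The symplectic group of `N ⊥ ψ₂` acts transitively on unimodular elements. -/
theorem exists_mem_Sp_apply_eq (F : AltForm R N) (hN : HasStableRange R N) (n : N) (x y : R)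
    (h : ∃ (l : N →ₗ[R] R) (α β : R), l n + α * x + β * y = 1) :
    ∃ ρ ∈ (F.perp (psiForm R)).Sp, ρ (n, x, y) = (0, 0, 1) := by
  obtain ⟨m, r, l, α, h1⟩ := hN n x y h
  have e1 : F.transvFst m (elemFst R N r (n, x, y)) =
      (n + y • m, x + r * y + F.form m n, y) := rfl
  set n₁ := n + y • m with hn₁
  set x₁ := x + r * y + F.form m n with hx₁
  -- The transvection has added `F(m, n)` to the first hyperbolic coordinate. The correction of `l`
  -- compensates for it, since `F(m, n₁) = F(m, n)`.
  let l₁ : N →ₗ[R] R := l - α • F.form m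
  have h2 : l₁ n₁ + α * x₁ = 1 := by
    rw [← h1]
    simp [l₁, hn₁, hx₁, F.alt]
    ring
  -- With this `m'` the last coordinate becomes `y + (1 - y)(l₁ n₁ + α x₁) = 1`.
  obtain ⟨m', hm'⟩ := F.bij.2 ((-(1 - y)) • l₁)
  have e2 : elemSnd R N ((1 - y) * α) (F.transvSnd m' (n₁, x₁, y)) = (n₁ + x₁ • m', x₁, 1) := by
    have : y - F.form m' n₁ + (1 - y) * α * x₁ = 1 := by
      rw [hm']
      simp only [LinearMap.smul_apply, smul_eq_mul]
      linear_combination (1 - y) * h2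
    ext
    · rfl
    · rfl
    · exact this
  set n₂ := n₁ + x₁ • m'
  have e3 : F.transvFst (-n₂) (n₂, x₁, 1) = (0, x₁, 1) := by
    ext <;> simp [transvFst, F.alt]
  have e4 : elemFst R N (-x₁) (0, x₁, 1) = (0, 0, 1) := by
    ext <;> simp [elemFst]
  refine ⟨elemFst R N (-x₁) * (F.transvFst (-n₂) * (elemSnd R N ((1 - y) * α) * (F.transvSnd m' *
    (F.transvFst m * elemFst R N r)))), ?_, ?_⟩
  · exact mul_mem (F.elemFst_mem_Sp _) (mul_mem (F.transvFst_mem_Sp _) (mul_mem (F.elemSnd_mem_Sp _)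
      (mul_mem (F.transvSnd_mem_Sp _) (mul_mem (F.transvFst_mem_Sp _) (F.elemFst_mem_Sp _)))))
  · simp only [LinearEquiv.mul_apply]
    rw [e1, e2, e3, e4]

/-- Cancellation of a hyperbolic plane. -/
theorem Isometric.of_perp_psiForm {F : AltForm R N} {F' : AltForm R N'}
    (hN' : HasStableRange R N') (h : (F.perp (psiForm R)).Isometric (F'.perp (psiForm R))) :
    F.Isometric F' := by
  obtain ⟨φ, hφ, hfix⟩ : ∃ φ : (N × R × R) ≃ₗ[R] (N' × R × R),
      (∀ z w, (F.perp (psiForm R)).form z w = (F'.perp (psiForm R)).form (φ z) (φ w)) ∧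
        φ (0, 0, 1) = (0, 0, 1) := by
    obtain ⟨φ, hφ⟩ := h
    obtain ⟨ρ, hρ, hρ'⟩ := F'.exists_mem_Sp_apply_eq hN' (φ (0, 0, 1)).1 (φ (0, 0, 1)).2.1
      (φ (0, 0, 1)).2.2 (by
        have h1 := hφ (0, 1, 0) (0, 0, 1)
        rw [perp_psiForm_form, perp_psiForm_form] at h1
        simp only [map_zero, mul_one, mul_zero, sub_zero, zero_add] at h1
        refine ⟨F'.form (φ (0, 1, 0)).1, -(φ (0, 1, 0)).2.2, (φ (0, 1, 0)).2.1, ?_⟩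
        linear_combination -h1)
    exact ⟨φ ≪≫ₗ ρ, fun z w => by rw [hφ]; exact (hρ _ _).symm, hρ'⟩
  have hfix' : φ.symm (0, 0, 1) = (0, 0, 1) := by rw [LinearEquiv.symm_apply_eq, hfix]
  -- The first hyperbolic coordinate is the pairing with `e₄`. As `φ` fixes `e₄`, it preserves this
  -- coordinate and induces an isometry between the quotients `e₄^⊥ / e₄`, which are `N` and `N'`.
  have hx : ∀ z, (φ z).2.1 = z.2.1 := by
    intro z
    have := hφ z (0, 0, 1)
    rw [hfix, perp_psiForm_form, perp_psiForm_form] at this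
    simpa using this.symm
  have hx' : ∀ z, (φ.symm z).2.1 = z.2.1 := fun z => by
    rw [← hx, LinearEquiv.apply_symm_apply]
  have hd : ∀ z : N × R × R, z.2.1 = 0 → z = (z.1, 0, 0) + z.2.2 • ((0, 0, 1) : N × R × R) := by
    intro z hz
    ext <;> simp [hz]
  have hd' : ∀ z : N' × R × R, z.2.1 = 0 →
      z = (z.1, 0, 0) + z.2.2 • ((0, 0, 1) : N' × R × R) := by
    intro z hz
    ext <;> simp [hz]
  refine ⟨{ LinearMap.fst R N' (R × R) ∘ₗ (φ : (N × R × R) →ₗ[R] (N' × R × R)) ∘ₗ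
      LinearMap.inl R N (R × R) with
    invFun := fun n => (φ.symm (n, 0, 0)).1
    left_inv := fun n => ?_
    right_inv := fun n => ?_ }, fun n n' => ?_⟩
  · change (φ.symm ((φ (n, 0, 0)).1, 0, 0)).1 = n
    have h1 := congrArg φ.symm (hd' (φ (n, 0, 0)) (hx _))
    rw [LinearEquiv.symm_apply_apply, map_add, map_smul, hfix'] at h1
    simpa using (congrArg Prod.fst h1).symm
  · change (φ ((φ.symm (n, 0, 0)).1, 0, 0)).1 = n
    have h1 := congrArg φ (hd (φ.symm (n, 0, 0)) (hx' _))
    rw [LinearEquiv.apply_symm_apply, map_add, map_smul, hfix] at h1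
    simpa using (congrArg Prod.fst h1).symm
  · change F.form n n' = F'.form (φ (n, 0, 0)).1 (φ (n', 0, 0)).1
    have h1 := hφ (n, 0, 0) (n', 0, 0)
    rw [perp_psiForm_form, perp_psiForm_form, hx, hx] at h1
    simpa using h1

end AltForm

end Cancellation

/-! ### From equality of classes in `V_SL(R)` to isometry. -/

section StableIsometry

variable {R : Type u} [CommRing R] {P P' : Type u} [AddCommGroup P] [Module R P]
  [Module.Finite R P] [Module.Projective R P] [AddCommGroup P'] [Module R P']
  [Module.Finite R P'] [Module.Projective R P']

/-- The class `[f] - [g]` of an isometry class of triples in the Grothendieck group of symplectic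
modules. -/
def grothendieckClass (x : IsometryClass R) : Algebra.GrothendieckAddGroup (SympClass R) :=
  Quotient.liftOn x (fun T => Algebra.GrothendieckAddGroup.of (SympClass.mk T.snd) -
    Algebra.GrothendieckAddGroup.of (SympClass.mk T.fst)) (by
      rintro S T ⟨e, h, h'⟩
      rw [SympClass.mk_eq_iff.2 ⟨e, h⟩, SympClass.mk_eq_iff.2 ⟨e, h'⟩])

theorem lift_grothendieckClass_gen (g f : AltForm R P) :
    FreeAbelianGroup.lift grothendieckClass (gen g f) =
      Algebra.GrothendieckAddGroup.of (SympClass.mk f) -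
        Algebra.GrothendieckAddGroup.of (SympClass.mk g) :=
  FreeAbelianGroup.lift_apply_of _ _

variable (R) in
/-- The homomorphism from `V_SL(R)` to the Grothendieck group of symplectic modules. -/
def symplecticHom : VSL R →+ Algebra.GrothendieckAddGroup (SympClass R) :=
  QuotientAddGroup.lift _ (FreeAbelianGroup.lift grothendieckClass) (by
    rw [AddSubgroup.closure_le]
    rintro _ (⟨⟨g, f, g', f'⟩ | ⟨f₀, f₁, f₂⟩⟩ | ⟨g, f, φ, -⟩)
    · simp only [SetLike.mem_coe, AddMonoidHom.mem_ker, map_sub, lift_grothendieckClass_gen,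
        SympClass.mk_perp, map_add]
      abel
    · simp only [SetLike.mem_coe, AddMonoidHom.mem_ker, map_sub, map_add,
        lift_grothendieckClass_gen]
      abel
    · simp only [SetLike.mem_coe, AddMonoidHom.mem_ker, map_sub, lift_grothendieckClass_gen]
      rw [SympClass.mk_eq_iff.2 (⟨φ, fun _ _ => rfl⟩ : (f.pullback φ).Isometric f), sub_self])

/-- The image in the Grothendieck group shows that `f` and `f'` become isometric after adding a
common summand. Enlarging that summand by a complement makes it hyperbolic. -/
theorem exists_add_nsmul_eq_of_cls_eq {g f f' : AltForm R P} (h : VSL.cls g f = VSL.cls g f') :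
    ∃ m : ℕ, SympClass.mk f + m • SympClass.mk (psiForm R) =
      SympClass.mk f' + m • SympClass.mk (psiForm R) := by
  have h1 : symplecticHom R (VSL.cls g f) = symplecticHom R (VSL.cls g f') := by rw [h]
  have h2 : Algebra.GrothendieckAddGroup.of (SympClass.mk f) =
      Algebra.GrothendieckAddGroup.of (SympClass.mk f') :=
    sub_left_injective (((lift_grothendieckClass_gen g f).symm.trans h1).trans
      (lift_grothendieckClass_gen g f'))
  obtain ⟨c, hc⟩ := (AddLocalization.addMonoidOf (⊤ : AddSubmonoid (SympClass R))).eq_iff_exists.1 h2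
  obtain ⟨y, m, hy⟩ := (c : SympClass R).exists_complement
  refine ⟨m, ?_⟩
  rw [← hy, ← add_assoc, ← add_assoc, add_comm _ (c : SympClass R), hc, add_comm (c : SympClass R)]

/-- The planes are cancelled one at a time. Those still present form the summand `N`, which is why
the stable range is required for `P' × N` and not only for `P'`. -/
theorem isometric_of_add_nsmul_eq (hst : ∀ (N : Type u) [AddCommGroup N] [Module R N],
    HasStableRange R (P' × N)) {f : AltForm R P} {f' : AltForm R P'} (m : ℕ)
    (h : SympClass.mk f + m • SympClass.mk (psiForm R) =
      SympClass.mk f' + m • SympClass.mk (psiForm R)) : f.Isometric f' := by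
  rw [← SympClass.mk_eq_iff]
  induction m with
  | zero => simpa using h
  | succ m ih =>
    refine ih ?_
    rw [succ_nsmul, ← add_assoc, ← add_assoc, ← SympClass.mk_power, ← SympClass.mk_perp,
      ← SympClass.mk_perp, ← SympClass.mk_perp, ← SympClass.mk_perp, SympClass.mk_eq_iff] at h
    rw [← SympClass.mk_power, ← SympClass.mk_perp, ← SympClass.mk_perp, SympClass.mk_eq_iff]
    exact h.of_perp_psiForm (hst _)

end StableIsometry

/-! ### The generalized Vaserstein symbol modulo `SL` -/

section VSLClasses

variable {R : Type u} [CommRing R] {P : Type u} [AddCommGroup P] [Module R P] [Module.Finite R P]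
  [Module.Projective R P]

theorem VSL.cls_pullback (g f : AltForm R P) {φ : P ≃ₗ[R] P} (hφ : φ ∈ SL R P) :
    VSL.cls g (f.pullback φ) = VSL.cls g f := by
  have h : (QuotientAddGroup.mk (gen g f - gen g (f.pullback φ)) : VSL R) = 0 :=
    (QuotientAddGroup.eq_zero_iff _).2 (AddSubgroup.subset_closure (VSLRelator.special g f φ hφ))
  rw [QuotientAddGroup.mk_sub, sub_eq_zero] at h
  exact h.symm

variable (R) in
/-- The projection from `V(R)` to `V_SL(R)`. -/
def toVSL : V R →+ VSL R :=
  QuotientAddGroup.map _ _ (AddMonoidHom.id _) (AddSubgroup.closure_mono fun _ h => VSLRelator.base h)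

theorem cls_mem_VtildeSL {g f : AltForm R P} (h : V.cls g f ∈ Vtilde R) :
    VSL.cls g f ∈ VtildeSL R := by
  have hle : Vtilde R ≤ (VtildeSL R).comap (toVSL R) := by
    rw [Vtilde, AddSubgroup.closure_le]
    rintro _ ⟨n, A, hA, hpf, rfl⟩
    exact AddSubgroup.subset_closure ⟨n, A, hA, hpf, rfl⟩
  exact hle h

end VSLClasses

section Symbol

variable {R : Type u} [CommRing R] {P₀ : Type u} [AddCommGroup P₀] [Module R P₀]
  [Module.Finite R P₀] [Module.Projective R P₀]
  (hrk : ∀ p : PrimeSpectrum R, Module.rankAtStalk P₀ p = 2) (θ₀ : R ≃ₗ[R] ⋀[R]^2 P₀)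

/-- The isometry between the two forms has determinant `1` because both have relative Pfaffian `1`.
-/
theorem cls_vasersteinForm_eq_of_section (a : (P₀ × R) →ₗ[R] R) (s s' : P₀ × R) (hs : a s = 1)
    (hs' : a s' = 1) : VSL.cls ((chi0 hrk θ₀).perp (psiForm R)) (vasersteinForm hrk θ₀ a s hs) =
      VSL.cls ((chi0 hrk θ₀).perp (psiForm R)) (vasersteinForm hrk θ₀ a s' hs') := by
  obtain ⟨φ, -, h⟩ := exists_vasersteinForm_eq_pullback hrk θ₀ a s s' hs hs'
  rw [h, VSL.cls_pullback]
  refine mem_SL_of_relPf_eq (g := (chi0 hrk θ₀).perp (psiForm R))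
    (f := vasersteinForm hrk θ₀ a s hs) ?_
  rw [← h, relPf_vasersteinForm, relPf_vasersteinForm]

theorem cls_vasersteinForm_eq_of_SL (a : (P₀ × R) →ₗ[R] R) (s : P₀ × R) (hs : a s = 1)
    {φ : (P₀ × R) ≃ₗ[R] (P₀ × R)} (hφ : φ ∈ SL R (P₀ × R)) (t : P₀ × R)
    (ht : (a ∘ₗ (φ : (P₀ × R) →ₗ[R] (P₀ × R))) t = 1) :
    VSL.cls ((chi0 hrk θ₀).perp (psiForm R)) (vasersteinForm hrk θ₀ a s hs) =
      VSL.cls ((chi0 hrk θ₀).perp (psiForm R)) (vasersteinForm hrk θ₀ _ t ht) := by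
  obtain ⟨t', ht', h⟩ := exists_pullback_vasersteinForm_eq hrk θ₀ a s hs hφ
  rw [cls_vasersteinForm_eq_of_section hrk θ₀ _ t t' ht ht', ← h,
    VSL.cls_pullback _ _ (extendFour_mem_SL hφ)]

/-- The generalized Vaserstein symbol modulo `SL`. -/
def vasersteinSymbol (x : UmModSL R (P₀ × R)) : VtildeSL R :=
  Quotient.liftOn x (fun a => ⟨VSL.cls ((chi0 hrk θ₀).perp (psiForm R))
      (vasersteinForm hrk θ₀ a.1 (a.2 1).choose (a.2 1).choose_spec),
    cls_mem_VtildeSL (mem_Vtilde_of_relPf_eq_one (relPf_vasersteinForm hrk θ₀ _ _ _))⟩) (by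
    rintro a ⟨_, hb⟩ ⟨φ, hφ, rfl⟩
    exact Subtype.ext (cls_vasersteinForm_eq_of_SL hrk θ₀ _ _ _ hφ _ _))

theorem vasersteinSymbol_mk (a : Um R (P₀ × R)) (s : P₀ × R) (hs : a.1 s = 1) :
    (vasersteinSymbol hrk θ₀ (UmModSL.mk a) : VSL R) =
      VSL.cls ((chi0 hrk θ₀).perp (psiForm R)) (vasersteinForm hrk θ₀ a.1 s hs) :=
  cls_vasersteinForm_eq_of_section hrk θ₀ a.1 _ s _ hs

/-- If the symbol is injective, then the symplectic groups act transitively on `SL(P₄) e₄`. -/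
theorem orbit_eq_of_injective (hinj : Function.Injective (vasersteinSymbol hrk θ₀))
    (χ : AltForm R (P₀ × R × R))
    (hχ : V.cls ((chi0 hrk θ₀).perp (psiForm R)) χ ∈ Vtilde R) :
    MulAction.orbit (SL R (P₀ × R × R)) ((0, 0, 1) : P₀ × R × R) =
      MulAction.orbit χ.Sp ((0, 0, 1) : P₀ × R × R) := by
  refine Set.Subset.antisymm ?_ ?_
  swap
  · rintro _ ⟨⟨ρ, hρ⟩, rfl⟩
    exact ⟨⟨ρ, Sp_le_SL χ hρ⟩, rfl⟩
  rintro _ ⟨⟨φ, hφ⟩, rfl⟩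
  have hpf := relPf_eq_one_of_mem_Vtilde hχ
  have hpf' : relPf ((chi0 hrk θ₀).perp (psiForm R)) (χ.pullback φ) = 1 := by
    rw [relPf_pullback_of_mem_SL _ _ hφ, hpf]
  -- Both `χ` and its pullback along `φ` are forms of the symbol, and their classes in `V_SL(R)`
  -- agree, so injectivity relates their linear forms.
  obtain ⟨s, hs, e⟩ := exists_eq_vasersteinForm hrk θ₀ hpf
  obtain ⟨t, ht, e'⟩ := exists_eq_vasersteinForm hrk θ₀ hpf'
  have hsurj : ∀ {l : P₀ × R →ₗ[R] R} {s : P₀ × R}, l s = 1 → Function.Surjective l :=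
    fun {l s} h r => ⟨r • s, by simp [h]⟩
  let a : Um R (P₀ × R) := ⟨pairFour χ, hsurj hs⟩
  let b : Um R (P₀ × R) := ⟨pairFour (χ.pullback φ), hsurj ht⟩
  have hab : UmModSL.mk a = UmModSL.mk b := by
    refine hinj (Subtype.ext ?_)
    rw [vasersteinSymbol_mk hrk θ₀ a s hs, vasersteinSymbol_mk hrk θ₀ b t ht]
    exact (congrArg (VSL.cls _) e).symm.trans
      ((VSL.cls_pullback _ χ hφ).symm.trans (congrArg (VSL.cls _) e'))
  obtain ⟨ψ, hψ, hb⟩ : ∃ ψ ∈ SL R (P₀ × R), b.1 = a.1 ∘ₗ (ψ : (P₀ × R) →ₗ[R] (P₀ × R)) :=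
    Quotient.exact hab
  obtain ⟨t', ht', h1⟩ := exists_pullback_vasersteinForm_eq hrk θ₀ (pairFour χ) s hs hψ
  have ht'' : pairFour (χ.pullback φ) t' = 1 := (LinearMap.congr_fun hb t').trans ht'
  obtain ⟨η, hη, h2⟩ := exists_vasersteinForm_eq_pullback hrk θ₀ (pairFour (χ.pullback φ)) t' t ht'' ht
  -- `σ` is an isometry from the pulled back form to `χ` that fixes `e₄`
  let σ := extendFour ψ * η
  have hσ : ∀ x y, χ.form (φ x) (φ y) = χ.form (σ x) (σ y) := by
    intro x y
    have f1 : χ.form (φ x) (φ y) =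
        (vasersteinForm hrk θ₀ (pairFour (χ.pullback φ)) t' ht'').form (η x) (η y) :=
      congrArg (fun f => f.form x y) (e'.trans h2)
    have f2 : χ.form (σ x) (σ y) =
        (vasersteinForm hrk θ₀ (pairFour χ ∘ₗ (ψ : (P₀ × R) →ₗ[R] (P₀ × R))) t' ht').form
          (η x) (η y) := by
      rw [← h1, AltForm.pullback_apply, ← e]
      rfl
    rw [f1, f2, vasersteinForm_apply, vasersteinForm_apply]
    have hb' : pairFour (χ.pullback φ) = pairFour χ ∘ₗ (ψ : (P₀ × R) →ₗ[R] (P₀ × R)) := hb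
    rw [hb']
  have hσ4 : σ (0, 0, 1) = (0, 0, 1) := by
    rw [LinearEquiv.mul_apply, hη, extendFour_fix]
  -- `φ` and `σ` pull `χ` back to the same form, so `φ σ⁻¹` preserves `χ`. It sends `e₄` to `φ e₄`
  -- because `σ` fixes `e₄`.
  refine ⟨⟨φ * σ⁻¹, fun x y => ?_⟩, ?_⟩
  · have := hσ (σ⁻¹ x) (σ⁻¹ y)
    rw [← LinearEquiv.mul_apply σ, ← LinearEquiv.mul_apply σ, mul_inv_cancel] at this
    exact this
  · change (φ * σ⁻¹) (0, 0, 1) = φ (0, 0, 1)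
    rw [LinearEquiv.mul_apply]
    congr 1
    conv_lhs => rw [← hσ4]
    exact σ.symm_apply_apply _

/-- If the symplectic groups act transitively on `SL(P₄) e₄`, then the symbol is injective. -/
theorem injective_of_orbit_eq [IsNoetherianRing R] (hdim : ringKrullDim R ≤ 4)
    (horb : ∀ χ : AltForm R (P₀ × R × R), V.cls ((chi0 hrk θ₀).perp (psiForm R)) χ ∈ Vtilde R →
      MulAction.orbit (SL R (P₀ × R × R)) ((0, 0, 1) : P₀ × R × R) =
        MulAction.orbit χ.Sp ((0, 0, 1) : P₀ × R × R)) :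
    Function.Injective (vasersteinSymbol hrk θ₀) := by
  intro x y hxy
  induction x using Quotient.inductionOn with | _ a => ?_
  induction y using Quotient.inductionOn with | _ b => ?_
  obtain ⟨s, hs⟩ := a.2 1
  obtain ⟨t, ht⟩ := b.2 1
  have hcls := (vasersteinSymbol_mk hrk θ₀ a s hs).symm.trans
    ((congrArg Subtype.val hxy).trans (vasersteinSymbol_mk hrk θ₀ b t ht))
  obtain ⟨m, hm⟩ := exists_add_nsmul_eq_of_cls_eq hcls
  obtain ⟨φ, hφ⟩ := (isometric_of_add_nsmul_eq
    (fun N _ _ => hasStableRange_of_ringKrullDim_le hdim θ₀ N) m hm).symm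
  have hpull : (vasersteinForm hrk θ₀ a.1 s hs).pullback φ = vasersteinForm hrk θ₀ b.1 t ht :=
    AltForm.ext_form fun x y => (hφ x y).symm
  have hφSL : φ ∈ SL R (P₀ × R × R) := by
    refine mem_SL_of_relPf_eq (g := (chi0 hrk θ₀).perp (psiForm R))
      (f := vasersteinForm hrk θ₀ a.1 s hs) ?_
    rw [hpull, relPf_vasersteinForm, relPf_vasersteinForm]
  -- The orbit condition is applied to the form `V(a, s)` itself, which satisfies its hypothesis by
  -- having relative Pfaffian `1`.
  have hmem : φ (0, 0, 1) ∈ MulAction.orbit (vasersteinForm hrk θ₀ a.1 s hs).Sp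
      ((0, 0, 1) : P₀ × R × R) := by
    rw [← horb _ (mem_Vtilde_of_relPf_eq_one (relPf_vasersteinForm hrk θ₀ _ _ _))]
    exact ⟨⟨φ, hφSL⟩, rfl⟩
  obtain ⟨⟨ρ, hρ⟩, hρφ⟩ := hmem
  have hρφ' : ρ (0, 0, 1) = φ (0, 0, 1) := hρφ
  -- Correcting `φ` by `ρ⁻¹`, an isometry of `V(a, s)`, keeps the pullback equal to `V(b, t)` and
  -- makes the map fix `e₄`, so it descends to `P₀ ⊕ R`.
  let σ := ρ⁻¹ * φ
  have hσ4 : σ (0, 0, 1) = (0, 0, 1) := by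
    rw [LinearEquiv.mul_apply, ← hρφ']
    exact ρ.symm_apply_apply _
  have hσSL : σ ∈ SL R (P₀ × R × R) := mul_mem (inv_mem (Sp_le_SL _ hρ)) hφSL
  refine Quotient.sound (s := umSetoid R (P₀ × R)) ⟨inducedThree σ hσ4,
    (inducedThree_mem_SL_iff σ hσ4).2 hσSL, LinearMap.ext fun x => ?_⟩
  have h2 := pairFour_vasersteinForm hrk θ₀ b.1 t ht
  -- Pairing with `e₄` recovers `a` from `V(a, s)`, so comparing the pairings of the two forms with
  -- `e₄` gives `b = a ∘ σ` on `P₀ ⊕ R`.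
  have h3 : ∀ z, (vasersteinForm hrk θ₀ a.1 s hs).form z (0, 0, 1) = a.1 (projThree R P₀ z) := by
    intro z
    rw [vasersteinForm_apply]
    have : a.1 ((0 : P₀), (0 : R)) = 0 := map_zero a.1
    simp [vol, this]
  have hinv := (inv_mem hρ : ρ⁻¹ ∈ (vasersteinForm hrk θ₀ a.1 s hs).Sp)
    (φ (inclThree R P₀ x)) (φ (0, 0, 1))
  have hσ4' : ρ⁻¹ (φ (0, 0, 1)) = (0, 0, 1) := hσ4
  rw [hσ4', h3, ← AltForm.pullback_apply, hpull] at hinv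
  have h4 : b.1 x = (vasersteinForm hrk θ₀ b.1 t ht).form (inclThree R P₀ x) (0, 0, 1) :=
    (LinearMap.congr_fun h2 x).symm
  rw [h4, ← hinv]
  rfl

end Symbol

end

end GenVaserstein

theorem theorem3p6 {R : Type u} [CommRing R] [IsNoetherianRing R] (hdim : ringKrullDim R ≤ 4)
    {P₀ : Type u} [AddCommGroup P₀] [Module R P₀] [Module.Finite R P₀] [Module.Projective R P₀]
    (hrk : ∀ p : PrimeSpectrum R, Module.rankAtStalk P₀ p = 2)
    (θ₀ : R ≃ₗ[R] ⋀[R]^2 P₀) :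
    ∃ symbol : UmModSL R (P₀ × R) → VtildeSL R,
      (∀ (a : Um R (P₀ × R)) (s : P₀ × R) (hs : a.1 s = 1),
        (symbol (UmModSL.mk a) : VSL R) =
          VSL.cls ((chi0 hrk θ₀).perp (psiForm R)) (vasersteinForm hrk θ₀ a.1 s hs)) ∧
      (Function.Injective symbol ↔
        ∀ χ : AltForm R (P₀ × R × R),
          V.cls ((chi0 hrk θ₀).perp (psiForm R)) χ ∈ Vtilde R →
            MulAction.orbit (SL R (P₀ × R × R)) ((0, 0, 1) : P₀ × R × R) =
              MulAction.orbit χ.Sp ((0, 0, 1) : P₀ × R × R)) := by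
  exact ⟨vasersteinSymbol hrk θ₀, vasersteinSymbol_mk hrk θ₀,
    orbit_eq_of_injective hrk θ₀, injective_of_orbit_eq hrk θ₀ hdim⟩
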